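/- Let $G=Sp_4(2)$, the group of $4\times 4$ symplectic matrices over $\mathbb F_2$; one has $G\cong S_6$. Let $O_4^-(2)\le G$ denote any subgroup consisting of the isometries of a quadratic form of Witt defect $1$ on $\mathbb F_2^4$ that polarizes to the symplectic form preserved by $G$; one has $O_4^-(2)\cong S_5$. Let $\mathbb F$ be an algebraically closed field of characteristic $\ell\ge 0$ with $\ell\ne 2$. Call $(G,V,H)$ a triple if $G$ is a finite group with $G/Z(G)$ almost simple, $V$ is an $\mathbb FG$-module of dimension greater than $1$, and $H$ is a proper subgroup of $G$ such that the restriction $V|_H$ is irreducible. If $(G,V,H)$ is a triple with $G=Sp_4(2)$ and $H$ a maximal subgroup of $G$, then one of the following holds: 1. $H\cong A_6$; 2. $H\cong S_5$, and $H$ is not one of the subgroups $O_4^-(2)$; 3. $H$ is one of the subgroups $O_4^-(2)\cong S_5$. Conversely, each of these three kinds of maximal subgroups exists in $G$, and for every maximal subgroup $H$ of $G$ as in 1, 2 or 3 there is an $\mathbb FG$-module $V$ such that $(G,V,H)$ is a triple. -/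

import Mathlib

universe u v

/-- A group is almost simple if it has a nonabelian simple normal subgroup `S` with trivial
centralizer, i.e. if conjugation embeds it between `S ≅ Inn S` and `Aut S`. -/
def IsAlmostSimple (G : Type*) [Group G] : Prop :=
  ∃ S : Subgroup G, S.Normal ∧ IsSimpleGroup S ∧ (∃ a b : S, a * b ≠ b * a) ∧
    Subgroup.centralizer (S : Set G) = ⊥

/-- `(G, V, H)` is a triple of the Aschbacher–Scott problem over the field `F`: `G` is a finite
group with `G / Z(G)` almost simple, `V` (given by `ρ`) is an `F G`-module of dimension greater
than one, and `H` is a proper subgroup such that the restriction of `V` to `H` is irreducible. -/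
structure IsIrreducibleRestrictionTriple {F G V : Type*} [Field F] [Group G] [AddCommGroup V]
    [Module F V] (ρ : Representation F G V) (H : Subgroup G) : Prop where
  finite : Finite G
  almostSimple : IsAlmostSimple (G ⧸ Subgroup.center G)
  one_lt_dim : 1 < Module.rank F V
  proper : H < ⊤
  irreducible : Representation.IsIrreducible (ρ.comp H.subtype : Representation F H V)

/-- The Witt index of a quadratic form: the largest dimension of a totally singular subspace. -/
noncomputable def wittIndex {K M : Type*} [Field K] [AddCommGroup M] [Module K M]
    (Q : QuadraticForm K M) : ℕ :=
  sSup {d | ∃ W : Submodule K M, (∀ w ∈ W, Q w = 0) ∧ Module.finrank K W = d}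

/-- The group `Sp₄(2)` of symplectic `4 × 4` matrices over the field with two elements. -/
abbrev Sp42 : Type := Matrix.symplecticGroup (Fin 2) (ZMod 2)

/-- The natural module `𝔽₂⁴` of `Sp₄(2)`, on which matrices act by `A *ᵥ x`. -/
abbrev NatMod42 : Type := Fin 2 ⊕ Fin 2 → ZMod 2

/-- `Q` polarizes to the symplectic form `(x, y) ↦ xᵀ J y` preserved by `Sp₄(2)`, and has Witt
defect one, i.e. its Witt index is one less than half of the dimension. -/
def IsMinusForm (Q : QuadraticForm (ZMod 2) NatMod42) : Prop :=
  (∀ x y : NatMod42, QuadraticMap.polar Q x y =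
    dotProduct x ((Matrix.J (Fin 2) (ZMod 2)).mulVec y)) ∧
  2 * (wittIndex Q + 1) = Module.finrank (ZMod 2) NatMod42

/-- The isometries of `Q` in `Sp₄(2)`. If `Q` polarizes to the symplectic form of `Sp₄(2)`, every
linear isometry of `Q` lies in `Sp₄(2)`, so that this is the full orthogonal group of `Q`. -/
def orthogonalSubgroup (Q : QuadraticForm (ZMod 2) NatMod42) : Subgroup Sp42 where
  carrier := {A | ∀ x : NatMod42, Q (A.1.mulVec x) = Q x}
  one_mem' := fun x => by simp
  mul_mem' := by
    intro A B hA hB x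
    have h : (A * B).1.mulVec x = A.1.mulVec (B.1.mulVec x) := by
      rw [Matrix.mulVec_mulVec]; rfl
    rw [h, hA, hB]
  inv_mem' := by
    intro A hA x
    have h : A.1.mulVec ((A⁻¹).1.mulVec x) = x := by
      rw [Matrix.mulVec_mulVec]
      have h2 : A.1 * (A⁻¹).1 = 1 := congrArg Subtype.val (mul_inv_cancel A)
      rw [h2, Matrix.one_mulVec]
    rw [← hA ((A⁻¹).1.mulVec x), h]

/-- `H` is isomorphic to the alternating group of degree six. -/
def IsA6 (H : Subgroup Sp42) : Prop :=
  Nonempty (H ≃* alternatingGroup (Fin 6))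

/-- `H` is a subgroup `O₄⁻(2)` of `Sp₄(2)`. -/
def IsO4Minus (H : Subgroup Sp42) : Prop :=
  ∃ Q : QuadraticForm (ZMod 2) NatMod42, IsMinusForm Q ∧ H = orthogonalSubgroup Q

/-- `H` is isomorphic to the symmetric group of degree five, but is not a subgroup `O₄⁻(2)`. -/
def IsOtherS5 (H : Subgroup Sp42) : Prop :=
  Nonempty (H ≃* Equiv.Perm (Fin 5)) ∧ ¬ IsO4Minus H

/-! `Sp₄(2)` permutes the six quadratic forms of Witt defect one (Arf invariant 1) that polarize to
the symplectic form. The action is faithful because these forms separate vectors, and each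
transposition is induced by a transvection. So `Sp₄(2) ≅ S₆` with the subgroups `O₄⁻(2)` as point
stabilizers (`exists_mulEquiv_perm`), and everything becomes a question about `S₆`, where "kind 2 or
3" means "index six".

Necessity (`eq_alternatingGroup_or_index_eq_six_of_isIrreducibleOn`). If 5 divides the order of `H`,
a five-cycle in `H` makes it transitive or fixes its only fixed point for all of `H`; maximality and
an index count leave `A₆` and index six. Otherwise `H` fixes a point, centralizes an involution, or
preserves a partition into two triples. A centralized involution acts as ±1 by Schur, so its
nontrivial commutators act trivially, `A₆` lies in the kernel and the dimension is at most one. For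
two triples, let `A`, `B` be the fixed spaces of the three-cycles `a`, `b` on them: `A + B` and `A ∩
B` are invariant, so `a` or `ab` has vanishing norm `1 + c + c²`, or `a = 1`. In characteristic
other than 2 a vanishing norm makes a four-group normalized by `c` act trivially, again a
contradiction.

Sufficiency (`exists_isIrreducibleOn_heartRepresentation`). `A₆` and the transitive subgroups of
index six are doubly transitive, with four elements of each two-point stabilizer regular on the
other points. Summing a vector over these four elements shows that the heart of the permutation
module is irreducible. Point stabilizers are reduced to this case by an outer automorphism, which
comes from `S₅` acting on its six Sylow 5-subgroups. -/

open Equiv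

/-! ### Schur's lemma for involutions, and four-groups acting trivially -/

section Irreducibility

variable {F : Type*} {G : Type*} {V : Type*} [Field F] [Group G] [AddCommGroup V] [Module F V]

/-- The restriction of `ρ` to the subgroup `H` is irreducible, in terms of submodules. -/
def IsIrreducibleOn (ρ : Representation F G V) (H : Subgroup G) : Prop :=
  Nontrivial V ∧ ∀ W : Submodule F V, (∀ h ∈ H, ∀ w ∈ W, ρ h w ∈ W) → W = ⊥ ∨ W = ⊤

theorem isIrreducibleOn_iff (ρ : Representation F G V) (H : Subgroup G) :
    Representation.IsIrreducible (ρ.comp H.subtype : Representation F H V) ↔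
      IsIrreducibleOn ρ H := by
  constructor
  · intro h
    refine ⟨?_, fun W hW => ?_⟩
    · by_contra hV
      rw [not_nontrivial_iff_subsingleton] at hV
      obtain ⟨x, y, hxy⟩ := h.toNontrivial
      exact hxy (Subrepresentation.toSubmodule_injective (Subsingleton.elim _ _))
    · let W' : Subrepresentation (ρ.comp H.subtype : Representation F H V) :=
        ⟨W, fun g v hv => hW g g.2 v hv⟩
      rcases h.eq_bot_or_eq_top W' with h' | h'
      · exact Or.inl (congrArg Subrepresentation.toSubmodule h')
      · exact Or.inr (congrArg Subrepresentation.toSubmodule h')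
  · rintro ⟨hV, h⟩
    refine { exists_pair_ne := ⟨⊥, ⊤, fun e => ?_⟩, eq_bot_or_eq_top := fun W => ?_ }
    · exact bot_ne_top (α := Submodule F V) (congrArg Subrepresentation.toSubmodule e)
    · rcases h W.toSubmodule (fun g hg w hw => W.apply_mem_toSubmodule ⟨g, hg⟩ hw) with h' | h'
      · exact Or.inl (Subrepresentation.toSubmodule_injective h')
      · exact Or.inr (Subrepresentation.toSubmodule_injective h')

variable {ρ : Representation F G V} {H : Subgroup G}

/-- The fixed space of `T` is invariant, hence zero or everything. It contains the image of `T + 1`,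
so if it is zero then `T = -1`. -/
theorem IsIrreducibleOn.involution_eq (h : IsIrreducibleOn ρ H) {T : Module.End F V}
    (hT : T * T = 1) (hc : ∀ g ∈ H, Commute (ρ g) T) : T = 1 ∨ T = -1 := by
  have hinv : ∀ g ∈ H, ∀ w ∈ LinearMap.ker (T - 1), ρ g w ∈ LinearMap.ker (T - 1) := by
    intro g hg w hw
    rw [LinearMap.mem_ker, LinearMap.sub_apply, Module.End.one_apply, sub_eq_zero] at hw ⊢
    have := LinearMap.congr_fun (hc g hg).eq w
    simp only [Module.End.mul_apply] at this
    rw [← this, hw]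
  rcases h.2 _ hinv with h' | h'
  · right
    ext v
    have h1 : (T + 1) v ∈ LinearMap.ker (T - 1) := by
      rw [LinearMap.mem_ker]
      change ((T - 1) * (T + 1)) v = 0
      have : (T - 1) * (T + 1) = T * T - 1 := by noncomm_ring
      rw [this, hT, sub_self, LinearMap.zero_apply]
    rw [h', Submodule.mem_bot] at h1
    simpa [eq_neg_iff_add_eq_zero] using h1
  · left
    exact sub_eq_zero.mp (LinearMap.ker_eq_top.mp h')

theorem IsIrreducibleOn.rank_le_one_of_forall_eq (h : IsIrreducibleOn ρ H)
    (hs : ∀ g ∈ H, ρ g = 1 ∨ ρ g = -1) : Module.rank F V ≤ 1 := by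
  obtain ⟨v, hv⟩ := @exists_ne V h.1 0
  have hinv : ∀ g ∈ H, ∀ w ∈ Submodule.span F {v}, ρ g w ∈ Submodule.span F {v} := by
    intro g hg w hw
    rcases hs g hg with e | e <;> rw [e]
    · simpa using hw
    · simpa using hw
  rcases h.2 _ hinv with h' | h'
  · exact absurd (Submodule.span_singleton_eq_bot.mp h') hv
  · rw [← rank_top, ← h']
    exact (rank_submodule_le_one_iff' _).mpr ⟨v, le_rfl⟩

/-- If `c` acts with `1 + c + c² = 0` and normalizes a four-group `{1, v, w, v w}`, permuting its
involutions cyclically, then the four-group acts trivially. -/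
theorem four_group_acts_trivially (ρ : Representation F G V) (h2 : (2 : F) ≠ 0) {c v w : G}
    (hc : ρ (1 : G) + ρ c + ρ (c * c) = 0) (hv : v * v = 1) (hw : w * w = 1)
    (hvw : v * w = w * v) (h1 : c * v = w * c) (h3 : c * w = v * w * c) : ρ v = 1 := by
  have conj : ∀ g : G, ρ (1 : G) + ρ (g * c * g⁻¹) + ρ ((g * c * g⁻¹) * (g * c * g⁻¹)) = 0 := by
    intro g
    have := congrArg (fun T => ρ g * T * ρ g⁻¹) hc
    simp only [mul_add, add_mul, ← map_mul, mul_zero, zero_mul] at this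
    have e1 : g * 1 * g⁻¹ = 1 := by group
    have e2 : (g * c * g⁻¹) * (g * c * g⁻¹) = g * (c * c) * g⁻¹ := by group
    rw [e2, ← this, e1]
  have iv : v⁻¹ = v := inv_eq_of_mul_eq_one_left hv
  have iw : w⁻¹ = w := inv_eq_of_mul_eq_one_left hw
  have vc : v * c = c * (v * w) := by
    have : c * (v * w) = v * c := by
      rw [← mul_assoc, h1, mul_assoc, h3, ← mul_assoc, hvw, ← mul_assoc, hw, one_mul]
    exact this.symm
  have wc : w * c = c * v := h1.symm
  have wv : w * v = v * w := hvw.symm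
  have e1 : v * c * v⁻¹ = c * w := by
    rw [iv, vc, mul_assoc, mul_assoc, wv, ← mul_assoc v, hv, one_mul]
  have e2 : w * c * w⁻¹ = c * (v * w) := by
    rw [iw, wc, mul_assoc]
  have e3 : (v * w) * c * (v * w)⁻¹ = c * v := by
    rw [mul_inv_rev, iv, iw, ← h3, mul_assoc, ← mul_assoc w, hw, one_mul]
  have s1 : (c * w) * (c * w) = c * c * (v * w) := by
    rw [mul_assoc, ← mul_assoc w, wc, mul_assoc c v w, mul_assoc]
  have s2 : (c * (v * w)) * (c * (v * w)) = c * c * v := by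
    rw [mul_assoc, ← mul_assoc (v * w), ← h3, mul_assoc c w, ← mul_assoc w, wv, mul_assoc v, hw,
      mul_one, mul_assoc]
  have s3 : (c * v) * (c * v) = c * c * w := by
    rw [mul_assoc, ← mul_assoc v, vc, mul_assoc c, mul_assoc v w v, wv, ← mul_assoc v, hv, one_mul,
      mul_assoc]
  have c1 := conj v
  have c2 := conj w
  have c3 := conj (v * w)
  rw [e1, s1] at c1
  rw [e2, s2] at c2
  rw [e3, s3] at c3
  simp only [map_mul, map_one] at hc c1 c2 c3
  have hv' : ρ v * ρ v = 1 := by rw [← map_mul, hv, map_one]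
  set C := ρ c
  set X := ρ v
  set Y := ρ w
  -- The four conjugates of `c` are `c` times the elements of the four-group. Adding their relations
  -- counts 1 four times and every `c x`, `c² x` once; comparing with `(1 + c + c²)` times the
  -- four-group sum gives the value 4 of that sum.
  have hS : 1 + X + Y + X * Y = 1 + 1 + 1 + 1 := by
    have k1 : (1 + C + C * C) * (1 + X + Y + X * Y) = 0 := by rw [hc, zero_mul]
    have k2 : (1 + C + C * C) * (1 + X + Y + X * Y) + (1 + 1 + 1 + 1) - (1 + X + Y + X * Y) = 0 := by
      calc _ = (1 + C + C * C) + (1 + C * Y + C * C * (X * Y)) +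
            (1 + C * (X * Y) + C * C * X) + (1 + C * X + C * C * Y) := by noncomm_ring
        _ = 0 := by rw [hc, c1, c2, c3]; simp
    rw [k1, zero_add, sub_eq_zero] at k2
    exact k2.symm
  -- `X` permutes the terms of the sum; since the sum is 4, this says `4 X = 4`.
  have hXS : X * (1 + X + Y + X * Y) = 1 + X + Y + X * Y := by
    have : X * (1 + X + Y + X * Y) = X + X * X + X * Y + (X * X) * Y := by noncomm_ring
    rw [this, hv', one_mul]; abel
  rw [hS] at hXS
  ext u
  have h4 : (4 : F) • X u = (4 : F) • u := by
    have e := LinearMap.congr_fun hXS u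
    simp only [mul_add, mul_one, LinearMap.add_apply, Module.End.one_apply] at e
    have e4 : (4 : F) = 1 + 1 + 1 + 1 := by norm_num
    simpa only [e4, add_smul, one_smul] using e
  have h4' : (4 : F) ≠ 0 := by
    have : (4 : F) = 2 * 2 := by norm_num
    rw [this]; exact mul_ne_zero h2 h2
  exact smul_right_injective V h4' h4

end Irreducibility

/-! ### Fixed spaces of two commuting elements of order three -/

section PairOfElements

variable {F : Type*} {G : Type*} {V : Type*} [Field F] [Group G] [AddCommGroup V] [Module F V]
  {ρ : Representation F G V} {H : Subgroup G}

theorem apply_mem_ker_of_conj {a b h : G} (hab : h * a = b * h ∨ h * a = b⁻¹ * h)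
    {w : V} (hw : ρ a w = w) : ρ b (ρ h w) = ρ h w := by
  rcases hab with e | e
  · rw [← Module.End.mul_apply, ← map_mul, ← e, map_mul, Module.End.mul_apply, hw]
  · have e' : b * h * a = h := by rw [mul_assoc, e, mul_inv_cancel_left]
    calc ρ b (ρ h w) = ρ b (ρ h (ρ a w)) := by rw [hw]
      _ = ρ (b * h * a) w := by simp only [map_mul, Module.End.mul_apply]
      _ = ρ h w := by rw [e']

/-- If `H` permutes the groups generated by two commuting elements `a`, `b` of order three and acts
irreducibly, then `a` or `a * b` has no fixed vectors, or `a` acts trivially. -/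
theorem IsIrreducibleOn.sum_eq_zero_or (hρ : IsIrreducibleOn ρ H) {a b : G}
    (hcomm : a * b = b * a) (ha3 : a * (a * a) = 1) (hb3 : b * (b * b) = 1)
    (hconj : ∀ h ∈ H,
      ((h * a = a * h ∨ h * a = a⁻¹ * h) ∧ (h * b = b * h ∨ h * b = b⁻¹ * h)) ∨
      ((h * a = b * h ∨ h * a = b⁻¹ * h) ∧ (h * b = a * h ∨ h * b = a⁻¹ * h))) :
    ρ (1 : G) + ρ a + ρ (a * a) = 0 ∨ ρ (1 : G) + ρ (a * b) + ρ ((a * b) * (a * b)) = 0 ∨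
      ρ a = 1 := by
  let A : Submodule F V := LinearMap.ker (ρ a - 1)
  let B : Submodule F V := LinearMap.ker (ρ b - 1)
  have memA : ∀ {w}, w ∈ A ↔ ρ a w = w := fun {w} => by
    simp only [A, LinearMap.mem_ker, LinearMap.sub_apply, Module.End.one_apply, sub_eq_zero]
  have memB : ∀ {w}, w ∈ B ↔ ρ b w = w := fun {w} => by
    simp only [B, LinearMap.mem_ker, LinearMap.sub_apply, Module.End.one_apply, sub_eq_zero]
  have hAB : ∀ h ∈ H, ((∀ w ∈ A, ρ h w ∈ A) ∧ (∀ w ∈ B, ρ h w ∈ B)) ∨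
      ((∀ w ∈ A, ρ h w ∈ B) ∧ (∀ w ∈ B, ρ h w ∈ A)) := by
    intro h hh
    simp only [memA, memB]
    exact (hconj h hh).imp
      (And.imp (fun e w hw => apply_mem_ker_of_conj e hw) fun e w hw => apply_mem_ker_of_conj e hw)
      (And.imp (fun e w hw => apply_mem_ker_of_conj e hw) fun e w hw => apply_mem_ker_of_conj e hw)
  have fixed : ∀ {x : G}, x * (x * x) = 1 → ∀ v,
      ρ x ((ρ (1 : G) + ρ x + ρ (x * x)) v) =
        (ρ (1 : G) + ρ x + ρ (x * x)) v := by
    intro x hx v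
    simp only [LinearMap.add_apply, map_add]
    rw [← Module.End.mul_apply, ← Module.End.mul_apply, ← Module.End.mul_apply, ← map_mul,
      ← map_mul, ← map_mul, hx, mul_one]
    abel
  have swap_fixed : ∀ {x y : G}, x * y = y * x → ∀ {v}, ρ x v = v →
      ρ x ((ρ (1 : G) + ρ y + ρ (y * y)) v) =
        (ρ (1 : G) + ρ y + ρ (y * y)) v := by
    intro x y hxy v hv
    have h1 : ρ x (ρ y v) = ρ y v := by
      rw [← Module.End.mul_apply, ← map_mul, hxy, map_mul, Module.End.mul_apply, hv]
    have h2 : ρ x (ρ (y * y) v) = ρ (y * y) v := by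
      rw [← Module.End.mul_apply, ← map_mul, ← mul_assoc, hxy, mul_assoc, hxy, ← mul_assoc, map_mul,
        Module.End.mul_apply, hv]
    simp only [LinearMap.add_apply, map_add, h1, h2, map_one, Module.End.one_apply, hv]
  have sup_inv : ∀ h ∈ H, ∀ w ∈ A ⊔ B, ρ h w ∈ A ⊔ B := by
    intro h hh w hw
    obtain ⟨x, hx, y, hy, rfl⟩ := Submodule.mem_sup.mp hw
    rw [map_add]
    rcases hAB h hh with e | e
    · exact Submodule.add_mem_sup (e.1 x hx) (e.2 y hy)
    · rw [add_comm]
      exact Submodule.add_mem_sup (e.2 y hy) (e.1 x hx)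
  have inf_inv : ∀ h ∈ H, ∀ w ∈ A ⊓ B, ρ h w ∈ A ⊓ B := by
    intro h hh w hw
    rcases hAB h hh with e | e
    · exact ⟨e.1 w hw.1, e.2 w hw.2⟩
    · exact ⟨e.2 w hw.2, e.1 w hw.1⟩
  rcases hρ.2 _ sup_inv with hs | hs
  · refine Or.inl (LinearMap.ext fun v => ?_)
    have : (ρ (1 : G) + ρ a + ρ (a * a)) v ∈ A ⊔ B :=
      Submodule.mem_sup_left (memA.mpr (fixed ha3 v))
    rwa [hs, Submodule.mem_bot] at this
  rcases hρ.2 _ inf_inv with hi | hi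
  -- Here `V = A + B`. On `A` the norm of `a * b` is the norm of `b`, on `B` it is the norm of `a`,
  -- and both take values in `A ⊓ B = 0`.
  · refine Or.inr (Or.inl (LinearMap.ext fun v => ?_))
    have hv : v ∈ A ⊔ B := by rw [hs]; trivial
    obtain ⟨x, hx, y, hy, rfl⟩ := Submodule.mem_sup.mp hv
    have hx' : (ρ (1 : G) + ρ b + ρ (b * b)) x ∈ A ⊓ B :=
      ⟨memA.mpr (swap_fixed hcomm (memA.mp hx)), memB.mpr (fixed hb3 x)⟩
    have hy' : (ρ (1 : G) + ρ a + ρ (a * a)) y ∈ A ⊓ B :=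
      ⟨memA.mpr (fixed ha3 y), memB.mpr (swap_fixed hcomm.symm (memB.mp hy))⟩
    rw [hi, Submodule.mem_bot] at hx' hy'
    rw [memA] at hx
    rw [memB] at hy
    simp only [map_mul, LinearMap.add_apply, Module.End.mul_apply] at hx' hy'
    have hab' : ρ a (ρ b x) = ρ b x := by
      rw [← Module.End.mul_apply, ← map_mul, hcomm, map_mul, Module.End.mul_apply, hx]
    have hab2 : ρ a (ρ b (ρ b x)) = ρ b (ρ b x) := by
      rw [← Module.End.mul_apply, ← map_mul, hcomm, map_mul, Module.End.mul_apply, hab']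
    have hba : ρ b (ρ a y) = ρ a y := by
      rw [← Module.End.mul_apply, ← map_mul, ← hcomm, map_mul, Module.End.mul_apply, hy]
    simp only [map_mul, map_add, LinearMap.add_apply, Module.End.mul_apply, hy, hba, hab', hab2,
      LinearMap.zero_apply]
    calc _ = (ρ 1 x + ρ b x + ρ b (ρ b x)) + (ρ 1 y + ρ a y + ρ a (ρ a y)) := by abel
      _ = 0 + 0 := by rw [hx', hy']
  · refine Or.inr (Or.inr (LinearMap.ext fun v => ?_))
    have hv : v ∈ A ⊓ B := by rw [hi]; trivial
    exact memA.mp hv.1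

end PairOfElements

/-! ### Subgroups of `S₆` that are reducible on every module -/

section SymmetricGroup

theorem alternatingGroup_le_of_mem {N : Subgroup (Perm (Fin 6))} [N.Normal] {g : Perm (Fin 6)}
    (hg : g ∈ N) (h1 : g ≠ 1) : alternatingGroup (Fin 6) ≤ N :=
  Perm.alternatingGroup_le_of_normal (by simp)
    ⟨⟨⟨g, hg⟩, 1, fun h => h1 (congrArg Subtype.val h)⟩⟩

theorem mul_self_mem_alternatingGroup (g : Perm (Fin 6)) : g * g ∈ alternatingGroup (Fin 6) := by
  rw [Perm.mem_alternatingGroup, map_mul, Int.units_mul_self]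

theorem commutator_mem_alternatingGroup (g h : Perm (Fin 6)) :
    g * h * g⁻¹ * h⁻¹ ∈ alternatingGroup (Fin 6) := by
  rw [Perm.mem_alternatingGroup]
  simp only [map_mul, map_inv]
  rw [mul_comm (Perm.sign g), mul_assoc (Perm.sign h), mul_inv_cancel, mul_one, mul_inv_cancel]

theorem exists_not_commute {z : Perm (Fin 6)} (hz : z ≠ 1) : ∃ g, g * z ≠ z * g := by
  by_contra! h
  obtain ⟨x, hx⟩ := not_forall.mp fun h' => hz (Perm.ext h')
  obtain ⟨y, hy⟩ : ∃ y : Fin 6, y ≠ x ∧ y ≠ z x := 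
    (by decide : ∀ x w : Fin 6, ∃ y, y ≠ x ∧ y ≠ w) x (z x)
  -- This transposition fixes `x` and moves `z x`, so it cannot commute with `z`.
  have := congrArg (fun p : Perm (Fin 6) => p x) (h (swap (z x) y))
  simp only [Perm.mul_apply, swap_apply_left, Perm.one_apply] at this hx
  rw [swap_apply_of_ne_of_ne (Ne.symm hx) hy.1.symm] at this
  exact hy.2 this

variable {F : Type*} {V : Type*} [Field F] [AddCommGroup V] [Module F V]
  {ρ : Representation F (Perm (Fin 6)) V} {H : Subgroup (Perm (Fin 6))}

/-- Squares and commutators are even, so the image of `ρ` is abelian of exponent dividing two and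
every element acts as ±1. -/
theorem not_isIrreducibleOn_of_alternatingGroup_le_ker (hρ : IsIrreducibleOn ρ H)
    (hd : 1 < Module.rank F V) (hk : alternatingGroup (Fin 6) ≤ MonoidHom.ker ρ) : False := by
  refine absurd (hρ.rank_le_one_of_forall_eq fun g hg => ?_) (not_le.mpr hd)
  refine hρ.involution_eq ?_ fun h hh => ?_
  · rw [← map_mul]
    exact hk (mul_self_mem_alternatingGroup g)
  · have e : h * g = (h * g * h⁻¹ * g⁻¹) * (g * h) := by group
    have e1 : ρ (h * g * h⁻¹ * g⁻¹) = 1 := hk (commutator_mem_alternatingGroup h g)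
    rw [Commute, SemiconjBy, ← map_mul, ← map_mul, e, map_mul, e1, one_mul]

theorem not_isIrreducibleOn_of_apply_eq_one (hρ : IsIrreducibleOn ρ H)
    (hd : 1 < Module.rank F V) {g : Perm (Fin 6)} (hg : g ≠ 1) (h : ρ g = 1) : False :=
  not_isIrreducibleOn_of_alternatingGroup_le_ker hρ hd
    (alternatingGroup_le_of_mem (N := MonoidHom.ker ρ) h hg)

/-- No module of dimension at least two is irreducible for a subgroup centralizing an involution. -/
theorem not_isIrreducibleOn_of_commute (hρ : IsIrreducibleOn ρ H) (hd : 1 < Module.rank F V)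
    {z : Perm (Fin 6)} (hz : z ≠ 1) (hz2 : z * z = 1) (hc : ∀ h ∈ H, h * z = z * h) : False := by
  obtain ⟨g, hg⟩ := exists_not_commute hz
  have key : ρ z = 1 ∨ ρ z = -1 := by
    refine hρ.involution_eq (by rw [← map_mul, hz2, map_one]) fun h hh => ?_
    rw [Commute, SemiconjBy, ← map_mul, ← map_mul, hc h hh]
  have hcom : ρ g * ρ z = ρ z * ρ g := by
    rcases key with e | e <;> rw [e] <;> simp
  -- A commutator with an element acting as ±1 acts trivially, and this one is not the identity.
  refine not_isIrreducibleOn_of_apply_eq_one hρ hd (g := g * z * (z * g)⁻¹) ?_ ?_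
  · rwa [Ne, mul_inv_eq_one]
  · rw [map_mul, map_mul, hcom, ← map_mul, ← map_mul, mul_inv_cancel, map_one]

/-- Each three-cycle generates the alternating group of its triple, and conjugation carries this to
the alternating group of the image triple. Verified by running over all 720 permutations. -/
theorem conj_threeCycle_of_preserves_partition : ∀ h : Perm (Fin 6),
    ((∀ i, i < 3 → h i < 3) ∨ (∀ i, i < 3 → ¬ h i < 3)) →
    ((h * c[0, 1, 2] = c[0, 1, 2] * h ∨ h * c[0, 1, 2] = c[0, 1, 2]⁻¹ * h) ∧
      (h * c[3, 4, 5] = c[3, 4, 5] * h ∨ h * c[3, 4, 5] = c[3, 4, 5]⁻¹ * h)) ∨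
    ((h * c[0, 1, 2] = c[3, 4, 5] * h ∨ h * c[0, 1, 2] = c[3, 4, 5]⁻¹ * h) ∧
      (h * c[3, 4, 5] = c[0, 1, 2] * h ∨ h * c[3, 4, 5] = c[0, 1, 2]⁻¹ * h)) := by
  set_option maxRecDepth 100000 in
  decide +kernel

theorem IsIrreducibleOn.comp_mulEquiv {G G' : Type*} [Group G] [Group G']
    {ρ : Representation F G V} {H : Subgroup G} (hρ : IsIrreducibleOn ρ H) (f : G' ≃* G) :
    IsIrreducibleOn (ρ.comp f.toMonoidHom : Representation F G' V) (H.comap f.toMonoidHom) := by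
  refine ⟨hρ.1, fun W hW => hρ.2 W fun h hh w hw => ?_⟩
  have := hW (f.symm h) (by simpa using hh) w hw
  simpa using this

/-- No module of dimension at least two is irreducible for a subgroup preserving a partition of
the six points into two triples. -/
theorem not_isIrreducibleOn_of_preserves_partition (h2 : (2 : F) ≠ 0) (hρ : IsIrreducibleOn ρ H)
    (hd : 1 < Module.rank F V)
    (hH : ∀ h ∈ H, (∀ i, i < 3 → h i < 3) ∨ (∀ i, i < 3 → ¬ h i < 3)) : False := by
  have hcomm : (c[0, 1, 2] : Perm (Fin 6)) * c[3, 4, 5] = c[3, 4, 5] * c[0, 1, 2] := by decide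
  rcases hρ.sum_eq_zero_or hcomm (by decide) (by decide)
    (fun h hh => conj_threeCycle_of_preserves_partition h (hH h hh)) with h | h | h
  -- The three-cycle on 0, 1, 2 normalizes the Klein four-group on the points 0, 1, 2, 3.
  · exact not_isIrreducibleOn_of_apply_eq_one hρ hd (g := c[0, 1] * c[2, 3]) (by decide)
      (four_group_acts_trivially ρ h2 (w := c[0, 3] * c[1, 2]) h (by decide) (by decide)
        (by decide) (by decide) (by decide))
  -- The product of the three-cycles permutes the pairs {0,3}, {1,4}, {2,5} cyclically, so it
  -- normalizes the four-group of even permutations preserving each pair.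
  · exact not_isIrreducibleOn_of_apply_eq_one hρ hd (g := c[0, 3] * c[1, 4]) (by decide)
      (four_group_acts_trivially ρ h2 (w := c[1, 4] * c[2, 5]) h (by decide) (by decide)
        (by decide) (by decide) (by decide))
  · exact not_isIrreducibleOn_of_apply_eq_one hρ hd (by decide) h

end SymmetricGroup

/-! ### Permutation groups of degree six: orbits and blocks -/

section PermutationGroups

open MulAction
open scoped Pointwise

variable {H : Subgroup (Perm (Fin 6))}

theorem Subgroup.smul_fin (h : H) (x : Fin 6) : h • x = (h : Perm (Fin 6)) x := rfl

theorem card_subgroup_dvd (H : Subgroup (Perm (Fin 6))) : Nat.card H ∣ 720 := by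
  have := Subgroup.card_subgroup_dvd_card H
  rwa [Nat.card_perm, Nat.card_fin] at this

theorem card_mul_index_eq (H : Subgroup (Perm (Fin 6))) : Nat.card H * H.index = 720 := by
  rw [Subgroup.card_mul_index, Nat.card_perm, Nat.card_fin]; rfl

theorem card_alternatingGroup_fin_six : Nat.card (alternatingGroup (Fin 6)) = 360 := by
  rw [nat_card_alternatingGroup, Nat.card_fin]; rfl

theorem card_eq_six_mul_card_stabilizer {G : Type*} [Group G] [MulAction G (Fin 6)]
    [IsPretransitive G (Fin 6)] (x : Fin 6) :
    Nat.card G = 6 * Nat.card (stabilizer G x) := by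
  have := Subgroup.card_mul_index (stabilizer G x)
  rw [index_stabilizer_of_transitive, Nat.card_fin] at this
  omega

theorem exists_mem_orderOf_eq {G : Type*} [Group G] (K : Subgroup G) [Finite K] {p : ℕ}
    (hp : p.Prime) (h : p ∣ Nat.card K) : ∃ g ∈ K, orderOf g = p := by
  have := Fact.mk hp
  obtain ⟨g, hg⟩ := exists_prime_orderOf_dvd_card' p h
  exact ⟨g, g.2, by rw [← hg, Subgroup.orderOf_coe]⟩

/-- A permutation of order five is a five-cycle. -/
theorem exists_fixed_of_orderOf_eq_five {g : Perm (Fin 6)} (hg : orderOf g = 5) :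
    ∃ i, g i = i ∧ ∀ j, j ≠ i → ∀ k, k ≠ i → ∃ n : ℤ, (g ^ n) j = k := by
  have hc : g.IsCycle := Perm.isCycle_of_prime_order' (by rw [hg]; norm_num) (by rw [hg]; simp)
  have hs : g.support.card = 5 := by rw [← hc.orderOf, hg]
  have hs' : g.supportᶜ.card = 1 := by rw [Finset.card_compl, hs]; rfl
  obtain ⟨i, hi⟩ := Finset.card_eq_one.mp hs'
  have hm : ∀ j, g j = j ↔ j = i := fun j => by
    rw [← Finset.mem_singleton (a := i), ← hi, Finset.mem_compl, Perm.mem_support, not_not]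
  refine ⟨i, (hm i).mpr rfl, fun j hj k hk => ?_⟩
  exact hc.exists_zpow_eq (fun h => hj ((hm j).mp h)) (fun h => hk ((hm k).mp h))

/-- A five-cycle in `H` is transitive on five points; an element of `H` moving the sixth point joins
it to them. -/
theorem isPretransitive_or_le_stabilizer (h5 : 5 ∣ Nat.card H) :
    IsPretransitive H (Fin 6) ∨ ∃ i : Fin 6, H ≤ stabilizer (Perm (Fin 6)) i := by
  obtain ⟨g, hg, ho⟩ := exists_mem_orderOf_eq H (by norm_num) h5
  obtain ⟨i, hi, hj⟩ := exists_fixed_of_orderOf_eq_five ho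
  by_cases hH : H ≤ stabilizer (Perm (Fin 6)) i
  · exact Or.inr ⟨i, hH⟩
  · left
    obtain ⟨h, hh, hne⟩ := Set.not_subset.mp hH
    have hne' : h i ≠ i := hne
    rw [isPretransitive_iff_base (h i)]
    intro y
    by_cases hy : y = i
    · exact ⟨⟨h, hh⟩⁻¹, by rw [hy, Subgroup.smul_fin]; simp⟩
    · obtain ⟨n, hn⟩ := hj _ hne' y hy
      exact ⟨⟨g, hg⟩ ^ n, by rw [Subgroup.smul_fin]; simpa using hn⟩

/-- A nontrivial normal subgroup of order not divisible by six of a transitive group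
has nontrivial blocks as orbits. -/
theorem exists_isBlock_of_normal [IsPretransitive H (Fin 6)] (N : Subgroup H) [N.Normal]
    (hN : N ≠ ⊥) (h6 : ¬ 6 ∣ Nat.card N) : ∃ B : Set (Fin 6), IsBlock H B ∧ ¬ IsTrivialBlock B := by
  obtain ⟨n, hn, hn1⟩ := (Subgroup.bot_or_exists_ne_one N).resolve_left hN
  obtain ⟨x, hx⟩ : ∃ x : Fin 6, n • x ≠ x := by
    by_contra! h
    exact hn1 (Subtype.ext (Perm.ext h))
  refine ⟨orbit N x, IsBlock.orbit_of_normal x, ?_⟩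
  rintro (h | h)
  · exact hx (h ⟨⟨n, hn⟩, rfl⟩ (mem_orbit_self x))
  · apply h6
    have := Subgroup.index_dvd_card (stabilizer N x)
    rwa [index_stabilizer, h, Set.ncard_univ, Nat.card_fin] at this

/-- Two three-cycles would leave no fixed point. -/
theorem isThreeCycle_of_orderOf_eq_three {g : Perm (Fin 6)} (hg : orderOf g = 3) {x : Fin 6}
    (hx : g x = x) : g.IsThreeCycle := by
  obtain ⟨n, hn⟩ := Perm.cycleType_prime_order (σ := g) (by rw [hg]; norm_num)
  have hs := g.sum_cycleType
  have : g.support.card < 6 := by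
    have := Finset.card_lt_univ_of_notMem (s := g.support) (x := x) (by simpa using hx)
    simpa using this
  rw [hn, hg, Multiset.sum_replicate] at hs
  have : n = 0 := by simp at hs; omega
  rw [Perm.IsThreeCycle, hn, this, hg]; rfl

theorem isPreprimitive_or_exists_isBlock [hT : IsPretransitive H (Fin 6)] :
    IsPreprimitive H (Fin 6) ∨ ∃ B : Set (Fin 6), IsBlock H B ∧ ¬ IsTrivialBlock B := by
  by_contra! h
  exact h.1 ⟨fun {B} hB => h.2 B hB⟩

/-- A transitive group of degree six and order prime to five is imprimitive. -/
theorem exists_isBlock [IsPretransitive H (Fin 6)] (h5 : ¬ 5 ∣ Nat.card H) :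
    ∃ B : Set (Fin 6), IsBlock H B ∧ ¬ IsTrivialBlock B := by
  have hcard := card_eq_six_mul_card_stabilizer (G := H) 0
  -- If 9 divides the order, a point stabilizer contains a three-cycle, and by Jordan's theorem a
  -- primitive `H` would contain `A₆`, whose order is divisible by 5. Otherwise the order divides
  -- 48.
  by_cases h9 : 9 ∣ Nat.card H
  · have h3 : 3 ∣ Nat.card (stabilizer H (0 : Fin 6)) := by omega
    obtain ⟨g, hg, ho⟩ := exists_mem_orderOf_eq _ (by norm_num) h3
    have h3c : (g : Perm (Fin 6)).IsThreeCycle :=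
      isThreeCycle_of_orderOf_eq_three (by rw [Subgroup.orderOf_coe, ho]) (x := 0) hg
    refine isPreprimitive_or_exists_isBlock.resolve_left fun hP => h5 ?_
    have hA := Perm.alternatingGroup_le_of_isPreprimitive_of_isThreeCycle_mem hP h3c g.2
    have := Subgroup.card_dvd_of_le hA
    rw [card_alternatingGroup_fin_six] at this
    omega
  · have h48 : Nat.card H ∣ 48 := by
      have hd := card_subgroup_dvd H
      have : Nat.Coprime (Nat.card H) 5 :=
        ((Nat.Prime.coprime_iff_not_dvd (by norm_num)).mpr h5).symm
      have hd' : Nat.card H ∣ 144 :=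
        this.dvd_of_dvd_mul_right (by norm_num; exact hd)
      have hle := Nat.le_of_dvd (by norm_num) hd'
      generalize Nat.card H = n at *
      interval_cases n <;> omega
    have : Fact (Nat.Prime 2) := ⟨by norm_num⟩
    obtain ⟨P⟩ : Nonempty (Sylow 2 H) := inferInstance
    obtain ⟨k, hk⟩ := P.isPGroup'.exists_card_eq
    have hidx : (P : Subgroup H).index ∣ 3 := by
      have h1 : (P : Subgroup H).index ∣ 3 * 16 := ((P : Subgroup H).index_dvd_card).trans h48
      have h2 : ¬ 2 ∣ (P : Subgroup H).index := P.not_dvd_index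
      exact (Nat.Coprime.pow_right 4
        ((Nat.Prime.coprime_iff_not_dvd (by norm_num)).mpr h2).symm).dvd_of_dvd_mul_right h1
    -- The Sylow 2-subgroup has index 1 or 3. If its core is trivial, `H` embeds in a group of order
    -- dividing 6, so it has order 6 and a normal subgroup of order 3; otherwise the core is a
    -- nontrivial normal 2-subgroup.
    by_cases hN : (P : Subgroup H).normalCore = ⊥
    · have hinj : Function.Injective (toPermHom H (H ⧸ (P : Subgroup H))) := by
        rw [← MonoidHom.ker_eq_bot_iff, ← Subgroup.normalCore_eq_ker, hN]
      have h6 : Nat.card H ∣ 6 := by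
        have := Subgroup.card_dvd_of_injective _ hinj
        rw [Nat.card_perm, ← Subgroup.index_eq_card] at this
        refine this.trans ?_
        exact (Nat.factorial_dvd_factorial (Nat.le_of_dvd (by norm_num) hidx))
      have hH6 : Nat.card H = 6 := Nat.dvd_antisymm h6 ⟨_, hcard⟩
      obtain ⟨g, hg, ho⟩ := exists_mem_orderOf_eq (⊤ : Subgroup H) (p := 3) (by norm_num)
        (by rw [Subgroup.card_top, hH6]; norm_num)
      have hc : Nat.card (Subgroup.zpowers g) = 3 := by rw [Nat.card_zpowers, ho]
      have : (Subgroup.zpowers g).Normal := by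
        apply Subgroup.normal_of_index_eq_two
        have := Subgroup.card_mul_index (Subgroup.zpowers g)
        rw [hc, hH6] at this
        omega
      refine exists_isBlock_of_normal (Subgroup.zpowers g) (fun h => ?_) (by rw [hc]; norm_num)
      rw [h, Subgroup.card_bot] at hc
      omega
    · refine exists_isBlock_of_normal _ hN fun h6 => ?_
      have : 6 ∣ 2 ^ k := h6.trans (hk ▸ Subgroup.card_dvd_of_le (Subgroup.normalCore_le _))
      have h3 : 3 ∣ 2 ^ k := Dvd.dvd.trans (by norm_num) this
      have := (Nat.Prime.dvd_of_dvd_pow (by norm_num) h3 : 3 ∣ 2)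
      omega

/-- A transitive group with a block of size two centralizes an involution. -/
theorem exists_involution_of_isBlock [IsPretransitive H (Fin 6)] {B : Set (Fin 6)}
    (hB : IsBlock H B) (h2 : B.ncard = 2) :
    ∃ z : Perm (Fin 6), z ≠ 1 ∧ z * z = 1 ∧ ∀ h ∈ H, h * z = z * h := by
  obtain ⟨p, q, hpq, rfl⟩ := Set.ncard_eq_two.mp h2
  let R : Fin 6 → Fin 6 → Prop := fun x y => x ≠ y ∧ ∃ h : H, x ∈ h • ({p, q} : Set (Fin 6)) ∧
    y ∈ h • ({p, q} : Set (Fin 6))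
  have hsym : ∀ {x y}, R x y → R y x := fun ⟨h1, h, h3, h4⟩ => ⟨h1.symm, h, h4, h3⟩
  have hsmul : ∀ {x y}, R x y → ∀ g : H, R (g • x) (g • y) := fun ⟨h1, h, h3, h4⟩ g =>
    ⟨fun e => h1 (MulAction.injective g e), g * h, by rw [mul_smul]; exact Set.smul_mem_smul_set h3,
      by rw [mul_smul]; exact Set.smul_mem_smul_set h4⟩
  have hex : ∀ x, ∃ y, R x y := by
    intro x
    obtain ⟨h, rfl⟩ := exists_smul_eq H p x
    exact ⟨h • q, fun e => hpq (MulAction.injective h e), h, Set.smul_mem_smul_set (by simp),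
      Set.smul_mem_smul_set (by simp)⟩
  have huniq : ∀ {x y y'}, R x y → R x y' → y = y' := by
    rintro x y y' ⟨h1, h, h2, h3⟩ ⟨h1', h', h2', h3'⟩
    have he : h • ({p, q} : Set (Fin 6)) = h' • ({p, q} : Set (Fin 6)) := by
      by_contra hne
      exact Set.disjoint_left.mp (hB hne) h2 h2'
    rw [← he] at h3'
    have key : ∀ {w}, w ∈ h • ({p, q} : Set (Fin 6)) → w = h • p ∨ w = h • q := by
      rintro w ⟨u, rfl | rfl, rfl⟩
      · exact Or.inl rfl
      · exact Or.inr rfl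
    rcases key h2 with rfl | rfl <;> rcases key h3 with rfl | rfl <;>
      rcases key h3' with rfl | rfl <;> simp_all
  -- `f` sends a point to the other point of the translate of the block through it; this is the
  -- required involution.
  choose f hf using hex
  have hff : Function.Involutive f := fun x => huniq (hf (f x)) (hsym (hf x))
  refine ⟨hff.toPerm, fun h => ?_, Perm.ext fun x => hff x, fun h hh => Perm.ext fun x => ?_⟩
  · exact (hf 0).1 (Perm.ext_iff.mp h 0).symm
  · exact huniq (hsmul (hf x) ⟨h, hh⟩) (hf (h x))

theorem exists_perm_of_ncard_eq_three {B : Set (Fin 6)} (hB : B.ncard = 3) :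
    ∃ σ : Perm (Fin 6), ∀ i, σ i ∈ B ↔ i < 3 := by
  classical
  have e : {x : Fin 6 // x < 3} ≃ {x // x ∈ B} := by
    apply Fintype.equivOfCardEq
    rw [← Nat.card_eq_fintype_card (α := {x // x ∈ B})]
    change _ = Nat.card B
    rw [Nat.card_coe_set_eq, hB]; rfl
  exact ⟨e.extendSubtype, fun i =>
    ⟨fun h => by_contra fun hi => e.extendSubtype_not_mem i hi h, e.extendSubtype_mem i⟩⟩

/-- A group of degree six and order prime to five fixes a point, centralizes an involution or
preserves a partition into two triples. -/
theorem fixes_or_centralizes_or_preserves (h5 : ¬ 5 ∣ Nat.card H) :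
    (∃ i : Fin 6, H ≤ stabilizer (Perm (Fin 6)) i) ∨
    (∃ z : Perm (Fin 6), z ≠ 1 ∧ z * z = 1 ∧ ∀ h ∈ H, h * z = z * h) ∨
    ∃ B : Set (Fin 6), B.ncard = 3 ∧
      ∀ h ∈ H, (∀ x ∈ B, h x ∈ B) ∨ (∀ x ∈ B, h x ∉ B) := by
  by_cases hT : IsPretransitive H (Fin 6)
  · obtain ⟨B, hB, hnt⟩ := exists_isBlock h5
    have hne : B.Nonempty := by
      rw [Set.nonempty_iff_ne_empty]
      rintro rfl
      exact hnt (Or.inl Set.subsingleton_empty)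
    have hd := hB.ncard_dvd_card hne
    rw [Nat.card_fin] at hd
    have h1 : B.ncard ≠ 1 := fun h => hnt (Or.inl (by
      obtain ⟨a, rfl⟩ := Set.ncard_eq_one.mp h
      exact Set.subsingleton_singleton))
    have h6 : B.ncard ≠ 6 := fun h => hnt (Or.inr (by
      rw [Set.eq_univ_iff_ncard, h, Nat.card_fin]))
    have hcases : B.ncard = 2 ∨ B.ncard = 3 := by
      have hle := Nat.le_of_dvd (by norm_num) hd
      generalize B.ncard = n at *
      interval_cases n <;> omega
    rcases hcases with h | h
    · exact Or.inr (Or.inl (exists_involution_of_isBlock hB h))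
    · refine Or.inr (Or.inr ⟨B, h, fun g hg => ?_⟩)
      rcases isBlock_iff_smul_eq_or_disjoint.mp hB ⟨g, hg⟩ with e | e
      · left
        intro x hx
        rw [← e]
        exact Set.smul_mem_smul_set hx
      · right
        intro x hx hx'
        exact Set.disjoint_left.mp e (Set.smul_mem_smul_set hx) hx'
  -- In the intransitive case, an orbit or its complement has at most three points.
  · obtain ⟨B, hB3, hB0, hinv⟩ : ∃ B : Set (Fin 6), B.ncard ≤ 3 ∧ 0 < B.ncard ∧
        ∀ h ∈ H, ∀ x ∈ B, h x ∈ B := by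
      have hinv : ∀ h ∈ H, ∀ x, h x ∈ orbit H (0 : Fin 6) ↔ x ∈ orbit H (0 : Fin 6) :=
        fun h hh x => by
          change (⟨h, hh⟩ : H) • x ∈ _ ↔ _
          rw [← orbit_eq_iff, orbit_smul, orbit_eq_iff]
      have hne : orbit H (0 : Fin 6) ≠ Set.univ := fun h => hT (by
        rw [isPretransitive_iff_base (0 : Fin 6)]
        intro y
        have : y ∈ orbit H (0 : Fin 6) := by rw [h]; trivial
        exact this)
      have hadd := Set.ncard_add_ncard_compl (orbit H (0 : Fin 6))
      have hpos : 0 < (orbit H (0 : Fin 6)).ncard :=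
        (Set.ncard_pos).mpr ⟨_, mem_orbit_self _⟩
      have hpos' : 0 < (orbit H (0 : Fin 6))ᶜ.ncard :=
        (Set.ncard_pos).mpr (Set.nonempty_compl.mpr hne)
      rw [Nat.card_fin] at hadd
      by_cases hle : (orbit H (0 : Fin 6)).ncard ≤ 3
      · exact ⟨_, hle, hpos, fun h hh x hx => (hinv h hh x).mpr hx⟩
      · exact ⟨_, by omega, hpos', fun h hh x hx hx' => hx ((hinv h hh x).mp hx')⟩
    have hcases : B.ncard = 1 ∨ B.ncard = 2 ∨ B.ncard = 3 := by omega
    rcases hcases with h | h | h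
    · obtain ⟨i, rfl⟩ := Set.ncard_eq_one.mp h
      exact Or.inl ⟨i, fun g hg => hinv g hg i rfl⟩
    · obtain ⟨p, q, hpq, rfl⟩ := Set.ncard_eq_two.mp h
      refine Or.inr (Or.inl ⟨swap p q, ?_, swap_mul_self p q, fun g hg => ?_⟩)
      · rwa [Ne, swap_eq_one_iff]
      · rw [mul_swap_eq_swap_mul]
        have hp := hinv g hg p (by simp)
        have hq := hinv g hg q (by simp)
        have hne : g p ≠ g q := fun e => hpq (g.injective e)
        simp only [Set.mem_insert_iff, Set.mem_singleton_iff] at hp hq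
        rcases hp with hp | hp <;> rcases hq with hq | hq <;> rw [hp, hq] <;>
          first | exact absurd (hp.trans hq.symm) hne | rw [swap_comm]
    · exact Or.inr (Or.inr ⟨B, h, fun g hg => Or.inl (hinv g hg)⟩)

end PermutationGroups

/-! ### Subgroups of index six and transitive maximal subgroups -/

section IndexSix

open MulAction

variable {H : Subgroup (Perm (Fin 6))}

/-- The kernel of the action on cosets is the normal core of `H`, and a nontrivial normal subgroup
of `S₆` contains `A₆`. -/
theorem alternatingGroup_le_or_toPermHom_injective (H : Subgroup (Perm (Fin 6))) :
    alternatingGroup (Fin 6) ≤ H ∨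
      Function.Injective (toPermHom (Perm (Fin 6)) (Perm (Fin 6) ⧸ H)) := by
  by_cases h : H.normalCore = ⊥
  · right
    rw [← MonoidHom.ker_eq_bot_iff, ← Subgroup.normalCore_eq_ker, h]
  · left
    exact (Perm.alternatingGroup_le_of_normal (by simp)
      ((Subgroup.nontrivial_iff_ne_bot _).mpr h)).trans H.normalCore_le

theorem not_alternatingGroup_le_of_index_eq_six (h : H.index = 6) :
    ¬ alternatingGroup (Fin 6) ≤ H := fun hA => by
  have h1 := Subgroup.card_le_of_le hA
  have h2 := card_mul_index_eq H
  rw [card_alternatingGroup_fin_six] at h1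
  rw [h] at h2
  omega

/-- A subgroup of index six is a point stabilizer up to an automorphism. -/
theorem exists_mulEquiv_of_index_eq_six (h : H.index = 6) :
    ∃ ψ : Perm (Fin 6) ≃* Perm (Fin 6), ∀ g, g ∈ H ↔ ψ g 0 = 0 := by
  classical
  have hinj := (alternatingGroup_le_or_toPermHom_injective H).resolve_left
    (not_alternatingGroup_le_of_index_eq_six h)
  have hc : Nat.card (Perm (Fin 6) ⧸ H) = 6 := h
  have hfin : Finite (Perm (Fin 6) ⧸ H) := Nat.finite_of_card_ne_zero (by omega)
  have hbij : Function.Bijective (toPermHom (Perm (Fin 6)) (Perm (Fin 6) ⧸ H)) :=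
    (Nat.bijective_iff_injective_and_card _).mpr ⟨hinj, by
      rw [Nat.card_perm, Nat.card_perm, hc, Nat.card_fin]⟩
  let e₀ : (Perm (Fin 6) ⧸ H) ≃ Fin 6 := Finite.equivFinOfCardEq hc
  -- The transposition relabels the cosets so that `H` itself becomes the point 0.
  let e := e₀.trans (swap (e₀ ((1 : Perm (Fin 6)) : Perm (Fin 6) ⧸ H)) 0)
  have he : e ((1 : Perm (Fin 6)) : Perm (Fin 6) ⧸ H) = 0 := by simp [e]
  refine ⟨(MulEquiv.ofBijective _ hbij).trans e.permCongrHom, fun g => ?_⟩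
  have hval : ((MulEquiv.ofBijective _ hbij).trans e.permCongrHom) g 0 =
      e (g • e.symm 0) := rfl
  rw [hval, ← he, e.symm_apply_apply, e.apply_eq_iff_eq, ← mem_stabilizer_iff,
    stabilizer_quotient]

theorem nonempty_stabilizer_mulEquiv :
    Nonempty (stabilizer (Perm (Fin 6)) (0 : Fin 6) ≃* Perm (Fin 5)) := by
  have hc : Nat.card {x : Fin 6 // x ≠ 0} = 5 := by
    rw [Nat.card_eq_fintype_card]; decide
  let f : Perm {x : Fin 6 // x ≠ 0} →* stabilizer (Perm (Fin 6)) (0 : Fin 6) :=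
    (Perm.ofSubtype).codRestrict _ fun g => Perm.ofSubtype_apply_of_not_mem g (by simp)
  have hf : Function.Bijective f := by
    constructor
    · intro a b hab
      exact Perm.ofSubtype_injective (congrArg Subtype.val hab)
    · rintro ⟨g, hg⟩
      have hg0 : g 0 = 0 := hg
      refine ⟨g.subtypePerm (fun x => ?_), Subtype.ext (Perm.ofSubtype_subtypePerm _ ?_)⟩
      · rw [not_iff_not, ← hg0, g.apply_eq_iff_eq, hg0]
      · rintro x hx rfl
        exact hx hg0
  exact ⟨(MulEquiv.ofBijective f hf).symm.trans
    (Finite.equivFinOfCardEq hc).permCongrHom⟩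

theorem eq_comap_stabilizer {ψ : Perm (Fin 6) ≃* Perm (Fin 6)} (hψ : ∀ g, g ∈ H ↔ ψ g 0 = 0) :
    H = (stabilizer (Perm (Fin 6)) (0 : Fin 6)).comap ψ.toMonoidHom := by
  ext g
  exact hψ g

theorem nonempty_mulEquiv_of_index_eq_six (h : H.index = 6) : Nonempty (H ≃* Perm (Fin 5)) := by
  obtain ⟨ψ, hψ⟩ := exists_mulEquiv_of_index_eq_six h
  obtain ⟨e⟩ := nonempty_stabilizer_mulEquiv
  have hmap : H.map ψ.toMonoidHom = stabilizer (Perm (Fin 6)) (0 : Fin 6) := by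
    rw [eq_comap_stabilizer hψ]
    exact Subgroup.map_comap_eq_self_of_surjective ψ.surjective _
  exact ⟨(ψ.subgroupMap H).trans ((MulEquiv.subgroupCongr hmap).trans e)⟩

theorem isCoatom_of_index_eq_six (h : H.index = 6) : IsCoatom H := by
  obtain ⟨ψ, hψ⟩ := exists_mulEquiv_of_index_eq_six h
  rw [eq_comap_stabilizer hψ]
  exact ((MulEquiv.comapSubgroup ψ).isCoatom_iff _).mpr
    (IsPreprimitive.isCoatom_stabilizer_of_isPreprimitive (Perm (Fin 6)) (0 : Fin 6))

theorem index_eq_six_of_mulEquiv (e : H ≃* Perm (Fin 5)) : H.index = 6 := by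
  have h1 := Nat.card_congr e.toEquiv
  have h2 := card_mul_index_eq H
  rw [Nat.card_perm, Nat.card_fin] at h1
  rw [h1, show (5 : ℕ).factorial = 120 from rfl] at h2
  omega

theorem index_stabilizer_fin_six (i : Fin 6) : (stabilizer (Perm (Fin 6)) i).index = 6 := by
  rw [index_stabilizer_of_transitive, Nat.card_fin]

theorem eq_of_le_of_index_eq_six {K : Subgroup (Perm (Fin 6))} (hHK : H ≤ K)
    (hH : H.index = 6) (hK : K.index = 6) : H = K :=
  Subgroup.eq_of_le_of_card_ge hHK (by
    have h1 := card_mul_index_eq H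
    have h2 := card_mul_index_eq K
    rw [hH] at h1
    rw [hK] at h2
    omega)

theorem isPretransitive_or_eq_stabilizer (h : H.index = 6) :
    IsPretransitive H (Fin 6) ∨ ∃ i : Fin 6, H = stabilizer (Perm (Fin 6)) i := by
  have hc := card_mul_index_eq H
  rw [h] at hc
  exact (isPretransitive_or_le_stabilizer (H := H) (by omega)).imp id
    fun ⟨i, hi⟩ => ⟨i, eq_of_le_of_index_eq_six hi h (index_stabilizer_fin_six i)⟩

theorem isCoatom_alternatingGroup : IsCoatom (alternatingGroup (Fin 6)) := by
  refine ⟨fun h => ?_, fun K hK => ?_⟩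
  · have := card_alternatingGroup_fin_six
    rw [h, Subgroup.card_top, Nat.card_perm, Nat.card_fin, show (6 : ℕ).factorial = 720 from rfl] at this
    omega
  · have h1 := Subgroup.relIndex_mul_index hK.le
    rw [alternatingGroup.index_eq_two] at h1
    have h2 : (alternatingGroup (Fin 6)).relIndex K ≠ 1 := fun h =>
      hK.not_ge (Subgroup.relIndex_eq_one.mp h)
    have h3 : K.index ∣ 2 := ⟨_, by rw [mul_comm]; exact h1.symm⟩
    rcases (Nat.dvd_prime Nat.prime_two).mp h3 with h | h
    · exact Subgroup.index_eq_one.mp h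
    · rw [h] at h1; omega

/-- There is a transitive subgroup of index six: `S₅` acting on its Sylow `5`-subgroups. -/
theorem exists_isPretransitive_index_eq_six :
    ∃ K : Subgroup (Perm (Fin 6)), K.index = 6 ∧ IsPretransitive K (Fin 6) := by
  have : Fact (Nat.Prime 5) := ⟨by norm_num⟩
  obtain ⟨P⟩ : Nonempty (Sylow 5 (Perm (Fin 5))) := inferInstance
  have hG : Nat.card (Perm (Fin 5)) = 120 := by rw [Nat.card_perm, Nat.card_fin]; rfl
  have hA : Nat.card (alternatingGroup (Fin 5)) = 60 := by
    rw [nat_card_alternatingGroup, Nat.card_fin]; rfl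
  have hP : Nat.card P = 5 := by
    rw [P.card_eq_multiplicity, hG, show (120 : ℕ) = 5 ^ 1 * 24 by norm_num,
      Nat.factorization_mul (by norm_num) (by norm_num),
      Nat.Prime.factorization_pow (by norm_num)]
    simp [Nat.factorization_eq_zero_of_not_dvd]
  have hidx : (P : Subgroup (Perm (Fin 5))).index = 24 := by
    have := Subgroup.card_mul_index (P : Subgroup (Perm (Fin 5)))
    rw [hG] at this
    change Nat.card P * _ = _ at this
    rw [hP] at this
    omega
  have hne1 : Nat.card (Sylow 5 (Perm (Fin 5))) ≠ 1 := by
    intro h1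
    have hs : Subsingleton (Sylow 5 (Perm (Fin 5))) := (Nat.card_eq_one_iff_unique.mp h1).1
    have hN : (P : Subgroup (Perm (Fin 5))).Normal := P.normal_of_subsingleton
    have := Perm.alternatingGroup_le_of_normal (α := Fin 5) (by simp)
      (N := (P : Subgroup (Perm (Fin 5)))) ((Subgroup.nontrivial_iff_ne_bot _).mpr fun hb => by
        have : Nat.card (P : Subgroup (Perm (Fin 5))) = 5 := hP
        rw [hb, Subgroup.card_bot] at this
        omega)
    have := Subgroup.card_le_of_le this
    rw [hA] at this
    change 60 ≤ Nat.card P at this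
    omega
  -- A divisor of 24 congruent to 1 modulo 5 is 1 or 6.
  have hcard : Nat.card (Sylow 5 (Perm (Fin 5))) = 6 := by
    have hd := P.card_dvd_index
    rw [hidx] at hd
    have hm := card_sylow_modEq_one 5 (Perm (Fin 5))
    have hle := Nat.le_of_dvd (by norm_num) hd
    rw [Nat.ModEq] at hm
    generalize Nat.card (Sylow 5 (Perm (Fin 5))) = n at *
    interval_cases n <;> omega
  let φ := toPermHom (Perm (Fin 5)) (Sylow 5 (Perm (Fin 5)))
  have hφ : Function.Injective φ := by
    rw [← MonoidHom.ker_eq_bot_iff]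
    by_contra hne
    have hle := Perm.alternatingGroup_le_of_normal (α := Fin 5) (by simp)
      ((Subgroup.nontrivial_iff_ne_bot φ.ker).mpr hne)
    -- The stabilizer of `P` has order 120 / 6 = 20, too small to contain `A₅`.
    have hle' : alternatingGroup (Fin 5) ≤ stabilizer (Perm (Fin 5)) P := fun g hg =>
      Perm.ext_iff.mp (hle hg : φ g = 1) P
    have h1 := Subgroup.card_le_of_le hle'
    have h2 := Subgroup.card_mul_index (stabilizer (Perm (Fin 5)) P)
    rw [index_stabilizer_of_transitive, hcard, hG] at h2
    omega
  let e : Sylow 5 (Perm (Fin 5)) ≃ Fin 6 := Finite.equivFinOfCardEq hcard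
  let f : Perm (Fin 5) →* Perm (Fin 6) := e.permCongrHom.toMonoidHom.comp φ
  have hf : Function.Injective f := e.permCongrHom.injective.comp hφ
  refine ⟨f.range, ?_, ⟨fun x y => ?_⟩⟩
  · have h1 := card_mul_index_eq f.range
    rw [← Nat.card_congr (MonoidHom.ofInjective hf).toEquiv, hG] at h1
    omega
  · obtain ⟨g, hg⟩ := exists_smul_eq (Perm (Fin 5)) (e.symm x) (e.symm y)
    refine ⟨⟨f g, g, rfl⟩, ?_⟩
    change e (g • e.symm x) = y
    rw [hg, e.apply_symm_apply]

/-- An involution without fixed points is a product of three transpositions, hence odd. -/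
theorem exists_fixed_of_orderOf_eq_two {g : Perm (Fin 6)} (hg : orderOf g = 2)
    (hA : g ∈ alternatingGroup (Fin 6)) : ∃ x, g x = x := by
  obtain ⟨n, hn⟩ := Perm.cycleType_prime_order (σ := g) (by rw [hg]; norm_num)
  by_contra! h
  have hs := g.sum_cycleType
  have hu : g.support = Finset.univ := Finset.eq_univ_iff_forall.mpr fun x => by simpa using h x
  rw [hn, hg, hu, Multiset.sum_replicate] at hs
  have hn2 : n = 2 := by simp at hs; omega
  rw [Perm.mem_alternatingGroup, Perm.sign_of_cycleType, hn, hg, hn2] at hA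
  simp at hA
  revert hA
  decide

/-- A transitive maximal subgroup of order divisible by five is `A₆` or has index six. -/
theorem eq_alternatingGroup_or_index_eq_six [IsPretransitive H (Fin 6)] (hH : IsCoatom H)
    (h5 : 5 ∣ Nat.card H) : H = alternatingGroup (Fin 6) ∨ H.index = 6 := by
  by_cases hHA : H ≤ alternatingGroup (Fin 6)
  · exact Or.inl ((hH.le_iff.mp hHA).resolve_left isCoatom_alternatingGroup.1).symm
  by_cases hAH : alternatingGroup (Fin 6) ≤ H
  · exact Or.inl ((isCoatom_alternatingGroup.le_iff.mp hAH).resolve_left hH.1)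
  right
  let K : Subgroup H := (alternatingGroup (Fin 6)).subgroupOf H
  have hK2 : K.index = 2 := by
    have hd : K.index ∣ 2 := by
      have := Subgroup.relIndex_dvd_index_of_normal (alternatingGroup (Fin 6)) H
      rwa [alternatingGroup.index_eq_two] at this
    refine ((Nat.dvd_prime Nat.prime_two).mp hd).resolve_left fun h1 => hHA ?_
    exact Subgroup.relIndex_eq_one.mp h1
  have hKn : K.Normal := Subgroup.normal_of_index_eq_two hK2
  obtain ⟨g, hg, ho⟩ := exists_mem_orderOf_eq H (by norm_num) h5
  obtain ⟨i, hi, hj⟩ := exists_fixed_of_orderOf_eq_five ho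
  have hgA : g ∈ alternatingGroup (Fin 6) := by
    have e : g = (g * g) * (g * g) * (g * g) := by
      have : g ^ 5 = 1 := by rw [← ho, pow_orderOf_eq_one]
      calc g = g ^ 5 * g := by rw [this, one_mul]
        _ = _ := by simp only [pow_succ, pow_zero, one_mul, mul_assoc]
    rw [e]
    exact mul_mem (mul_mem (mul_self_mem_alternatingGroup g) (mul_self_mem_alternatingGroup g))
      (mul_self_mem_alternatingGroup g)
  let c : K := ⟨⟨g, hg⟩, hgA⟩
  obtain ⟨x, hx⟩ := exists_ne i
  -- The orbit contains the five points moved by `g`; being a block of `H`, it is everything.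
  have horb : orbit K x = Set.univ := by
    apply (IsBlock.orbit_of_normal (G := H) (N := K) x).eq_univ_of_card_lt
    have hsub : ({i}ᶜ : Set (Fin 6)) ⊆ orbit K x := by
      intro y hy
      obtain ⟨n, hn⟩ := hj x hx y hy
      exact ⟨c ^ n, by
        change ((((c ^ n : K) : H) : Perm (Fin 6))) x = y
        simpa [c] using hn⟩
    have h1 := Set.ncard_le_ncard hsub
    have h2 := Set.ncard_add_ncard_compl ({i} : Set (Fin 6))
    rw [Set.ncard_singleton, Nat.card_fin] at h2
    rw [Nat.card_fin]
    omega
  have hKT : IsPretransitive K (Fin 6) := by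
    rw [isPretransitive_iff_base x]
    intro y
    have : y ∈ orbit K x := by rw [horb]; trivial
    exact this
  have hK5 : 5 ∣ Nat.card K := by
    have : orderOf c = 5 := by
      rw [← ho, ← Subgroup.orderOf_coe, ← Subgroup.orderOf_coe]
    rw [← this]
    exact orderOf_dvd_natCard c
  have hK6 := card_eq_six_mul_card_stabilizer (G := K)
  have hHK : Nat.card K * 2 = Nat.card H := by rw [← hK2, Subgroup.card_mul_index]
  have hHi := card_mul_index_eq H
  have hinj := (alternatingGroup_le_or_toPermHom_injective H).resolve_left hAH
  have hfac : 720 ∣ H.index.factorial := by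
    have := Subgroup.card_dvd_of_injective _ hinj
    rwa [Nat.card_perm, Nat.card_perm, Nat.card_fin, ← Subgroup.index_eq_card] at this
  -- The order of `K` is divisible by 6 (transitivity) and by 5, and `K` has index two in `H`.
  have h60 : 60 ∣ Nat.card H := by
    have := hK6 0
    omega
  obtain ⟨m, hm⟩ := h60
  have h12 : H.index ∣ 12 := ⟨m, by
    rw [hm] at hHi
    nlinarith⟩
  have hle := Nat.le_of_dvd (by norm_num) h12
  -- With index 12, `K` would have order 30 and point stabilizers of order 5; but an involution in
  -- `K` is even, so it fixes a point.
  have h12' : H.index ≠ 12 := by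
    intro h
    rw [h] at hHi
    have hK30 : Nat.card K = 30 := by omega
    obtain ⟨t, -, ht⟩ := exists_mem_orderOf_eq (⊤ : Subgroup K) Nat.prime_two
      (by rw [Subgroup.card_top, hK30]; norm_num)
    obtain ⟨y, hy⟩ := exists_fixed_of_orderOf_eq_two (g := ((t : H) : Perm (Fin 6)))
      (by rw [Subgroup.orderOf_coe, Subgroup.orderOf_coe, ht]) t.2
    have hmem : t ∈ stabilizer K y := hy
    have hd := Subgroup.orderOf_dvd_natCard _ hmem
    have := hK6 y
    rw [ht] at hd
    omega
  generalize H.index = n at *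
  interval_cases n <;> first | rfl | omega | (norm_num [Nat.factorial] at hfac)

end IndexSix

/-! ### Double transitivity and regular two-point stabilizers -/

section TwoPointStabilizers

open MulAction

/-- `H` is doubly transitive on six points, and for any two points it contains four permutations
fixing both of them and acting regularly on the remaining four points. -/
structure HasRegularTwoPointStabilizers (H : Subgroup (Perm (Fin 6))) : Prop where
  two_transitive : ∀ i j k l : Fin 6, i ≠ j → k ≠ l → ∃ g ∈ H, g i = k ∧ g j = l
  regular : ∀ i j : Fin 6, i ≠ j → ∃ S : Finset (Perm (Fin 6)), S.card = 4 ∧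
    (∀ s ∈ S, s ∈ H ∧ s i = i ∧ s j = j) ∧
    ∀ k l : Fin 6, k ≠ i → k ≠ j → l ≠ i → l ≠ j → ∃ s ∈ S, s k = l

theorem exists_perm_two_points {i j k l : Fin 6} (hij : i ≠ j) (hkl : k ≠ l) :
    ∃ σ : Perm (Fin 6), σ i = k ∧ σ j = l := by
  refine ⟨swap (swap i k j) l * swap i k, ?_, by simp⟩
  rw [Perm.mul_apply, swap_apply_left, swap_apply_of_ne_of_ne _ hkl]
  intro h
  have := congrArg (swap i k) h
  rw [swap_apply_right, swap_apply_self] at this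
  exact hij this

/-- A transposition of two points other than the targets corrects the sign. The Klein four-group on
the remaining four points is even and regular. -/
theorem hasRegularTwoPointStabilizers_alternatingGroup :
    HasRegularTwoPointStabilizers (alternatingGroup (Fin 6)) where
  two_transitive i j k l hij hkl := by
    obtain ⟨σ, h1, h2⟩ := exists_perm_two_points hij hkl
    by_cases hσ : σ ∈ alternatingGroup (Fin 6)
    · exact ⟨σ, hσ, h1, h2⟩
    · obtain ⟨m, n, hmn, hmk, hml, hnk, hnl⟩ :=
        (by decide : ∀ k l : Fin 6, ∃ m n, m ≠ n ∧ k ≠ m ∧ l ≠ m ∧ k ≠ n ∧ l ≠ n) k l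
      refine ⟨swap m n * σ, ?_, ?_, ?_⟩
      · rw [Perm.mem_alternatingGroup] at hσ ⊢
        rw [map_mul, Perm.sign_swap hmn, (Int.units_eq_one_or _).resolve_left hσ]; rfl
      · rw [Perm.mul_apply, h1, swap_apply_of_ne_of_ne hmk hnk]
      · rw [Perm.mul_apply, h2, swap_apply_of_ne_of_ne hml hnl]
  regular i j hij := by
    obtain ⟨σ, h1, h2⟩ := exists_perm_two_points (i := 0) (j := 1) (by decide) hij
    let S₀ : Finset (Perm (Fin 6)) :=
      {1, swap 2 3 * swap 4 5, swap 2 4 * swap 3 5, swap 2 5 * swap 3 4}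
    have hS₀ : ∀ s ∈ S₀, Perm.sign s = 1 ∧ s 0 = 0 ∧ s 1 = 1 := by decide +kernel
    have hreg : ∀ k l : Fin 6, k ≠ 0 → k ≠ 1 → l ≠ 0 → l ≠ 1 → ∃ s ∈ S₀, s k = l := by decide +kernel
    have i0 : σ⁻¹ i = 0 := Perm.inv_eq_iff_eq.mpr h1.symm
    have j1 : σ⁻¹ j = 1 := Perm.inv_eq_iff_eq.mpr h2.symm
    refine ⟨S₀.map (MulAut.conj σ).toEquiv.toEmbedding, ?_, ?_, ?_⟩
    · rw [Finset.card_map]; decide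
    · intro s hs
      obtain ⟨t, ht, rfl⟩ := Finset.mem_map.mp hs
      obtain ⟨t1, t2, t3⟩ := hS₀ t ht
      change σ * t * σ⁻¹ ∈ _ ∧ (σ * t * σ⁻¹) i = i ∧ (σ * t * σ⁻¹) j = j
      refine ⟨?_, ?_, ?_⟩
      · rw [Perm.mem_alternatingGroup]; simp [t1]
      · rw [Perm.mul_apply, Perm.mul_apply, i0, t2, h1]
      · rw [Perm.mul_apply, Perm.mul_apply, j1, t3, h2]
    · intro k l hki hkj hli hlj
      have aux : ∀ {x y z : Fin 6}, x ≠ y → σ⁻¹ y = z → σ⁻¹ x ≠ z := fun h e h' =>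
        h (σ⁻¹.injective (h'.trans e.symm))
      obtain ⟨s, hs, hkl⟩ := hreg (σ⁻¹ k) (σ⁻¹ l) (aux hki i0) (aux hkj j1) (aux hli i0)
        (aux hlj j1)
      refine ⟨_, Finset.mem_map_of_mem _ hs, ?_⟩
      change (σ * s * σ⁻¹) k = l
      rw [Perm.mul_apply, Perm.mul_apply, hkl]; simp

/-- The stabilizer of `i` has order 20, so it contains a five-cycle, whose only fixed point is `i`.
-/
theorem two_transitive_of_index_eq_six {H : Subgroup (Perm (Fin 6))} [IsPretransitive H (Fin 6)]
    (h6 : H.index = 6) {i : Fin 6} {j k : Fin 6} (hj : j ≠ i) (hk : k ≠ i) :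
    ∃ g : stabilizer H i, g • j = k := by
  have hc := card_mul_index_eq H
  have hs := card_eq_six_mul_card_stabilizer (G := H) i
  rw [h6] at hc
  obtain ⟨g, hg, ho⟩ := exists_mem_orderOf_eq (stabilizer H i) (p := 5) (by norm_num) (by omega)
  rw [← Subgroup.orderOf_coe] at ho
  have hgi : (g : Perm (Fin 6)) i = i := hg
  obtain ⟨i', hi', htr⟩ := exists_fixed_of_orderOf_eq_five ho
  obtain rfl : i' = i := by
    by_contra hne
    obtain ⟨m, hmi, hmi'⟩ : ∃ m : Fin 6, m ≠ i ∧ m ≠ i' :=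
      (by decide : ∀ a b : Fin 6, ∃ m, m ≠ a ∧ m ≠ b) i i'
    obtain ⟨n, hn⟩ := htr i (Ne.symm hne) m hmi'
    rw [Perm.zpow_apply_eq_self_of_apply_eq_self hgi] at hn
    exact hmi hn.symm
  obtain ⟨n, hn⟩ := htr j hj k hk
  refine ⟨⟨g, hg⟩ ^ n, ?_⟩
  change ((((⟨g, hg⟩ : stabilizer H i') ^ n : stabilizer H i') : H) : Perm (Fin 6)) j = k
  simpa using hn

/-- A two-point stabilizer has order 4. A nontrivial element of it fixing a third point would be a
transposition, whose conjugates in `H` would generate `S₆`, or a three-cycle, whose order does not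
divide 4. So it acts freely, hence regularly, on four points. -/
theorem hasRegularTwoPointStabilizers_of_index_eq_six {H : Subgroup (Perm (Fin 6))}
    [IsPretransitive H (Fin 6)] (h6 : H.index = 6) : HasRegularTwoPointStabilizers H := by
  have h2t : ∀ i j k l : Fin 6, i ≠ j → k ≠ l → ∃ g ∈ H, g i = k ∧ g j = l := by
    intro i j k l hij hkl
    obtain ⟨h, hh⟩ := exists_smul_eq H i k
    have hne : h • j ≠ k := fun e => hij (MulAction.injective h (hh.trans e.symm))
    obtain ⟨g, hg⟩ := two_transitive_of_index_eq_six h6 hne hkl.symm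
    refine ⟨(g : H) * h, mul_mem (g : H).2 h.2, ?_, hg⟩
    change (g : H) • h • i = k
    rw [hh]
    exact g.2
  have hswap : ∀ g ∈ H, ¬ g.IsSwap := by
    rintro g hg ⟨a, b, hab, rfl⟩
    have : H = ⊤ := by
      rw [eq_top_iff, ← Perm.closure_isSwap, Subgroup.closure_le]
      rintro _ ⟨x, y, hxy, rfl⟩
      obtain ⟨g, hgH, rfl, rfl⟩ := h2t a b x y hab hxy
      rw [swap_apply_apply]
      exact mul_mem (mul_mem hgH hg) (inv_mem hgH)
    rw [this, Subgroup.index_top] at h6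
    omega
  refine ⟨h2t, fun i j hij => ?_⟩
  have hc := card_mul_index_eq H
  have hs := card_eq_six_mul_card_stabilizer (G := H) i
  rw [h6] at hc
  let K := stabilizer H i
  have hK : Nat.card K = 20 := by change Nat.card (stabilizer H i) = 20; omega
  let D := stabilizer K j
  have horb : orbit K j = ({i}ᶜ : Set (Fin 6)) := by
    ext k
    constructor
    · rintro ⟨g, rfl⟩ hgi
      exact hij (MulAction.injective g ((g.2 : (g : H) • i = i).trans hgi.symm))
    · intro hk
      exact two_transitive_of_index_eq_six h6 hij.symm hk
  have hcompl : ({i}ᶜ : Set (Fin 6)).ncard = 5 := by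
    have h := Set.ncard_add_ncard_compl ({i} : Set (Fin 6))
    rw [Set.ncard_singleton, Nat.card_fin] at h
    omega
  have hD : Nat.card D = 4 := by
    have h := Subgroup.card_mul_index D
    rw [index_stabilizer, horb, hcompl, hK] at h
    omega
  let ι : D → Perm (Fin 6) := fun d => (((d : K) : H) : Perm (Fin 6))
  have hι : Function.Injective ι :=
    Subtype.val_injective.comp (Subtype.val_injective.comp Subtype.val_injective)
  have hιi : ∀ d, ι d i = i := fun d => (d : K).2
  have hιj : ∀ d, ι d j = j := fun d => d.2
  have hfix : ∀ k, k ≠ i → k ≠ j → stabilizer D k = ⊥ := by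
    intro k hki hkj
    rw [Subgroup.eq_bot_iff_forall]
    intro t ht
    have htk : ι t k = k := ht
    by_contra hne
    have hne' : ι t ≠ 1 := fun h => hne (hι h)
    have hsupp : (ι t).support.card ≤ 3 := by
      have hsub : (ι t).support ⊆ ({i, j, k} : Finset (Fin 6))ᶜ := by
        intro x hx
        rw [Perm.mem_support] at hx
        simp only [Finset.mem_compl, Finset.mem_insert, Finset.mem_singleton, not_or]
        exact ⟨fun h => hx (h ▸ hιi t), fun h => hx (h ▸ hιj t), fun h => hx (h ▸ htk)⟩
      have h1 := Finset.card_le_card hsub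
      rw [Finset.card_compl, Finset.card_eq_three.mpr ⟨i, j, k, hij, hki.symm, hkj.symm, rfl⟩] at h1
      exact h1
    have h4 : orderOf (ι t) ∣ 4 := by
      have h : orderOf t ∣ 4 := hD ▸ orderOf_dvd_natCard t
      simpa only [ι, Subgroup.orderOf_coe] using h
    have h0 : (ι t).support.card ≠ 0 := fun h => hne' (Perm.card_support_eq_zero.mp h)
    have h1 := Perm.card_support_ne_one (ι t)
    have h2 : (ι t).support.card ≠ 2 := fun h =>
      hswap _ ((t : K) : H).2 (Perm.card_support_eq_two.mp h)
    have h3 : (ι t).support.card = 3 := by omega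
    rw [(card_support_eq_three_iff.mp h3).orderOf] at h4
    omega
  have : Fintype D := Fintype.ofFinite D
  refine ⟨Finset.univ.map ⟨ι, hι⟩, ?_, ?_, ?_⟩
  · rw [Finset.card_map, Finset.card_univ, ← Nat.card_eq_fintype_card, hD]
  · intro s hs
    obtain ⟨d, -, rfl⟩ := Finset.mem_map.mp hs
    exact ⟨((d : K) : H).2, hιi d, hιj d⟩
  · intro k l hki hkj hli hlj
    have hn : (orbit D k).ncard = 4 := by
      rw [← index_stabilizer, hfix k hki hkj, Subgroup.index_bot, hD]
    have hsub : orbit D k ⊆ ({i, j}ᶜ : Set (Fin 6)) := by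
      rintro _ ⟨d, rfl⟩
      simp only [Set.mem_compl_iff, Set.mem_insert_iff, Set.mem_singleton_iff, not_or]
      exact ⟨fun h => hki ((ι d).injective (h.trans (hιi d).symm)),
        fun h => hkj ((ι d).injective (h.trans (hιj d).symm))⟩
    have hn' : ({i, j}ᶜ : Set (Fin 6)).ncard = 4 := by
      have h := Set.ncard_add_ncard_compl ({i, j} : Set (Fin 6))
      rw [Set.ncard_pair hij, Nat.card_fin] at h
      omega
    have heq := Set.eq_of_subset_of_ncard_le hsub (by rw [hn, hn'])
    have hl : l ∈ orbit D k := by rw [heq]; simp [hli, hlj]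
    obtain ⟨d, hd⟩ := hl
    exact ⟨ι d, Finset.mem_map_of_mem _ (Finset.mem_univ d), hd⟩

end TwoPointStabilizers

/-! ### The heart of the permutation module -/

section Heart

variable (F : Type u) [Field F]

/-- The permutation module of degree six. -/
def permutationRepresentation : Representation F (Perm (Fin 6)) (Fin 6 → F) where
  toFun g := LinearMap.funLeft F F ⇑g⁻¹
  map_one' := by ext; simp
  map_mul' g h := by ext; simp

theorem permutationRepresentation_apply (g : Perm (Fin 6)) (w : Fin 6 → F) (k : Fin 6) :
    permutationRepresentation F g w k = w (g⁻¹ k) := rfl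

/-- The vectors with coordinate sum zero. -/
def sumZero : Submodule F (Fin 6 → F) where
  carrier := {w | ∑ k, w k = 0}
  add_mem' {a b} ha hb := by
    change ∑ k, (a k + b k) = 0
    rw [Finset.sum_add_distrib, show ∑ k, a k = 0 from ha, show ∑ k, b k = 0 from hb, add_zero]
  zero_mem' := by simp
  smul_mem' c a ha := by
    change ∑ k, c * a k = 0
    rw [← Finset.mul_sum, show ∑ k, a k = 0 from ha, mul_zero]

/-- The constant vectors. -/
def constVectors : Submodule F (Fin 6 → F) where
  carrier := {w | ∀ i j, w i = w j}
  add_mem' {a b} ha hb i j := by simp [ha i j, hb i j]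
  zero_mem' _ _ := rfl
  smul_mem' c a ha i j := by simp [ha i j]

theorem permutationRepresentation_mem_sumZero (g : Perm (Fin 6)) :
    sumZero F ≤ (sumZero F).comap (permutationRepresentation F g) := fun w (hw : ∑ k, w k = 0) => by
  change ∑ k, w (g⁻¹ k) = 0
  rw [Equiv.sum_comp g⁻¹ w, hw]

/-- The action on vectors with coordinate sum zero. -/
def sumZeroRepresentation : Representation F (Perm (Fin 6)) (sumZero F) :=
  (permutationRepresentation F).subrepresentation (sumZero F)
    (permutationRepresentation_mem_sumZero F)

/-- The constant vectors with coordinate sum zero. -/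
def constSumZero : Submodule F (sumZero F) := (constVectors F).comap (sumZero F).subtype

theorem sumZeroRepresentation_mem_constSumZero (g : Perm (Fin 6)) :
    constSumZero F ≤ (constSumZero F).comap (sumZeroRepresentation F g) := fun _ hw i j =>
  hw (g⁻¹ i) (g⁻¹ j)

/-- The heart of the permutation module of degree six. -/
abbrev Heart : Type u := sumZero F ⧸ constSumZero F

/-- The action of the symmetric group on the heart of the permutation module. -/
def heartRepresentation : Representation F (Perm (Fin 6)) (Heart F) :=
  (sumZeroRepresentation F).quotient (constSumZero F) (sumZeroRepresentation_mem_constSumZero F)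

/-- The difference of two standard basis vectors. -/
def basisDiff (i j : Fin 6) : Fin 6 → F := Pi.single i (1 : F) - Pi.single j (1 : F)

theorem basisDiff_mem_sumZero (i j : Fin 6) : basisDiff F i j ∈ sumZero F := by
  change ∑ k, ((Pi.single i (1 : F) : Fin 6 → F) k - (Pi.single j (1 : F) : Fin 6 → F) k) = 0
  rw [Finset.sum_sub_distrib, Finset.sum_pi_single', Finset.sum_pi_single']
  simp

theorem permutationRepresentation_basisDiff (g : Perm (Fin 6)) (i j : Fin 6) :
    permutationRepresentation F g (basisDiff F i j) = basisDiff F (g i) (g j) := by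
  ext k
  rw [permutationRepresentation_apply]
  simp only [basisDiff, Pi.sub_apply, Pi.single_apply, Perm.inv_eq_iff_eq]

theorem sumZero_le_of_basisDiff_mem {U : Submodule F (Fin 6 → F)}
    (h : ∀ k l, k ≠ l → basisDiff F k l ∈ U) : sumZero F ≤ U := by
  intro w hw
  have hw0 : ∑ k, w k = 0 := hw
  have : w = ∑ k, w k • basisDiff F k 0 := by
    ext m
    simp only [Finset.sum_apply, Pi.smul_apply, basisDiff, Pi.sub_apply, smul_eq_mul, mul_sub,
      Finset.sum_sub_distrib, ← Finset.sum_mul, hw0, zero_mul, sub_zero]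
    simp [Pi.single_apply]
  rw [this]
  refine U.sum_mem fun k _ => U.smul_mem _ ?_
  by_cases hk : k = 0
  · rw [hk, basisDiff, sub_self]; exact U.zero_mem
  · exact h k 0 hk

variable {F}

/-- Take `w` in `U` with `w i ≠ w j` and sum it over the four elements regular off `i`, `j`. The sum
is constant off `i`, `j`, so subtracting its image under an element exchanging `i` and `j` leaves `4
(w i - w j)` times a difference of basis vectors. Double transitivity then yields all such
differences. -/
theorem le_constVectors_or_sumZero_le (h2 : (2 : F) ≠ 0) {H : Subgroup (Perm (Fin 6))}
    (hH : HasRegularTwoPointStabilizers H) {U : Submodule F (Fin 6 → F)}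
    (hU : ∀ h ∈ H, ∀ w ∈ U, permutationRepresentation F h w ∈ U) :
    U ≤ constVectors F ∨ sumZero F ≤ U := by
  by_cases hc : U ≤ constVectors F
  · exact Or.inl hc
  right
  obtain ⟨w, hw, hwc⟩ := Set.not_subset.mp hc
  obtain ⟨i, j, hne⟩ : ∃ i j, w i ≠ w j := by
    by_contra! h
    exact hwc h
  have hij : i ≠ j := fun h => hne (congrArg w h)
  obtain ⟨S, hS4, hSfix, hSreg⟩ := hH.regular i j hij
  obtain ⟨u, hu⟩ : ∃ u, u = ∑ s ∈ S, permutationRepresentation F s w := ⟨_, rfl⟩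
  have huU : u ∈ U := hu ▸ U.sum_mem fun s hs => hU s (hSfix s hs).1 w hw
  have hu_apply : ∀ k, u k = ∑ s ∈ S, w (s⁻¹ k) := fun k => by
    rw [hu, Finset.sum_apply]; rfl
  have hfixed : ∀ k, (∀ s ∈ S, s k = k) → u k = 4 * w k := fun k hk => by
    rw [hu_apply, Finset.sum_congr rfl fun s hs => by rw [Perm.inv_eq_iff_eq.mpr (hk s hs).symm],
      Finset.sum_const, hS4]
    simp
  have hui := hfixed i fun s hs => (hSfix s hs).2.1
  have huj := hfixed j fun s hs => (hSfix s hs).2.2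
  have hother : ∀ k, k ≠ i → k ≠ j → u k = ∑ m ∈ ({i, j} : Finset (Fin 6))ᶜ, w m := by
    intro k hki hkj
    have hcard : (({i, j} : Finset (Fin 6))ᶜ).card = 4 := by
      rw [Finset.card_compl, Finset.card_pair hij]; rfl
    have hsub : ({i, j} : Finset (Fin 6))ᶜ ⊆ S.image fun s => s⁻¹ k := by
      intro m hm
      simp only [Finset.mem_compl, Finset.mem_insert, Finset.mem_singleton, not_or] at hm
      obtain ⟨s, hs, hsm⟩ := hSreg m k hm.1 hm.2 hki hkj
      exact Finset.mem_image.mpr ⟨s, hs, Perm.inv_eq_iff_eq.mpr hsm.symm⟩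
    have himg : S.image (fun s => s⁻¹ k) = ({i, j} : Finset (Fin 6))ᶜ :=
      (Finset.eq_of_subset_of_card_le hsub (by
        rw [hcard, ← hS4]; exact Finset.card_image_le)).symm
    have hinj : Set.InjOn (fun s : Perm (Fin 6) => s⁻¹ k) S :=
      Finset.card_image_iff.mp (by rw [himg, hcard, hS4])
    rw [hu_apply, ← himg, Finset.sum_image hinj]
  obtain ⟨g, hg, hgi, hgj⟩ := hH.two_transitive i j j i hij hij.symm
  have hgi' : g⁻¹ j = i := Perm.inv_eq_iff_eq.mpr hgi.symm
  have hgj' : g⁻¹ i = j := Perm.inv_eq_iff_eq.mpr hgj.symm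
  have hdiff : u - permutationRepresentation F g u = (4 * w i - 4 * w j) • basisDiff F i j := by
    ext k
    rw [Pi.sub_apply, permutationRepresentation_apply, Pi.smul_apply, basisDiff, Pi.sub_apply,
      smul_eq_mul]
    by_cases hki : k = i
    · rw [hki, hgj', hui, huj]
      simp [hij]
    by_cases hkj : k = j
    · rw [hkj, hgi', hui, huj]
      simp [hij.symm]
    · rw [hother k hki hkj, hother (g⁻¹ k) (fun h => hkj ?_) (fun h => hki ?_)]
      · simp [hki, hkj]
      · exact g⁻¹.injective (h.trans hgi'.symm)
      · exact g⁻¹.injective (h.trans hgj'.symm)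
  have hscal : 4 * w i - 4 * w j ≠ 0 := by
    rw [← mul_sub]
    refine mul_ne_zero ?_ (sub_ne_zero.mpr hne)
    rw [show (4 : F) = 2 * 2 by norm_num]
    exact mul_ne_zero h2 h2
  have hmem : basisDiff F i j ∈ U := by
    have h := U.sub_mem huU (hU g hg u huU)
    rw [hdiff] at h
    exact (U.smul_mem_iff hscal).mp h
  refine sumZero_le_of_basisDiff_mem F fun k l hkl => ?_
  obtain ⟨g, hg, rfl, rfl⟩ := hH.two_transitive i j k l hij hkl
  rw [← permutationRepresentation_basisDiff]
  exact hU g hg _ hmem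

variable (F) in
theorem one_lt_rank_heart : 1 < Module.rank F (Heart F) := by
  let v : Fin 6 → Fin 6 → Heart F := fun i j =>
    (constSumZero F).mkQ ⟨basisDiff F i j, basisDiff_mem_sumZero F i j⟩
  have hli : LinearIndependent F ![v 0 1, v 0 2] := by
    rw [LinearIndependent.pair_iff]
    intro s t hst
    rw [← map_smul, ← map_smul, ← map_add, Submodule.mkQ_apply, Submodule.Quotient.mk_eq_zero] at hst
    have hst' : ∀ i j, (s • basisDiff F 0 1 + t • basisDiff F 0 2) i =
        (s • basisDiff F 0 1 + t • basisDiff F 0 2) j := hst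
    -- Both vectors vanish at coordinate 3, so a constant combination of them also vanishes at 1 and
    -- 2.
    have h1 := hst' 1 3
    have h2 := hst' 2 3
    simp [basisDiff] at h1 h2
    exact ⟨h1, h2⟩
  have := hli.cardinal_lift_le_rank
  rw [Cardinal.mk_fin, Cardinal.lift_natCast, Cardinal.lift_id'] at this
  exact lt_of_lt_of_le (by norm_num) this

/-- An invariant subspace of the heart is pulled back to the permutation module, where the dichotomy
above applies. -/
theorem isIrreducibleOn_heartRepresentation (h2 : (2 : F) ≠ 0) {H : Subgroup (Perm (Fin 6))}
    (hH : HasRegularTwoPointStabilizers H) : IsIrreducibleOn (heartRepresentation F) H := by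
  refine ⟨rank_pos_iff_nontrivial.mp (zero_lt_one.trans (one_lt_rank_heart F)), fun W hW => ?_⟩
  let U : Submodule F (Fin 6 → F) := (W.comap (constSumZero F).mkQ).map (sumZero F).subtype
  have memU : ∀ x : sumZero F, (x : Fin 6 → F) ∈ U ↔ (constSumZero F).mkQ x ∈ W := fun x => by
    constructor
    · rintro ⟨y, hy, hyx⟩
      rwa [← Subtype.ext (a1 := y) (a2 := x) hyx]
    · exact fun hx => ⟨x, hx, rfl⟩
  have hU : ∀ h ∈ H, ∀ w ∈ U, permutationRepresentation F h w ∈ U := by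
    rintro h hh _ ⟨y, hy, rfl⟩
    exact (memU (sumZeroRepresentation F h y)).mpr (hW h hh _ hy)
  rcases le_constVectors_or_sumZero_le h2 hH hU with h | h
  · left
    rw [eq_bot_iff]
    intro x hx
    obtain ⟨y, rfl⟩ := (constSumZero F).mkQ_surjective x
    have hy : y ∈ constSumZero F := h ((memU y).mpr hx)
    rw [Submodule.mem_bot, Submodule.mkQ_apply, Submodule.Quotient.mk_eq_zero]
    exact hy
  · right
    rw [eq_top_iff]
    intro x _
    obtain ⟨y, rfl⟩ := (constSumZero F).mkQ_surjective x
    exact (memU y).mp (h y.2)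

end Heart

/-! ### The classification inside `S₆` -/

section Conclusions

open MulAction

/-- The alternating group and each subgroup of index six act irreducibly on the heart of the
permutation module, twisted by an automorphism. -/
theorem exists_isIrreducibleOn_heartRepresentation {F : Type u} [Field F] (h2 : (2 : F) ≠ 0)
    {H : Subgroup (Perm (Fin 6))} (hH : H = alternatingGroup (Fin 6) ∨ H.index = 6) :
    ∃ θ : Perm (Fin 6) ≃* Perm (Fin 6),
      IsIrreducibleOn ((heartRepresentation F).comp θ.toMonoidHom :
        Representation F (Perm (Fin 6)) (Heart F)) H := by
  suffices h : ∃ θ : Perm (Fin 6) ≃* Perm (Fin 6),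
      HasRegularTwoPointStabilizers (H.map θ.toMonoidHom) by
    obtain ⟨θ, hθ⟩ := h
    refine ⟨θ, ?_⟩
    have := (isIrreducibleOn_heartRepresentation h2 hθ).comp_mulEquiv θ
    rwa [Subgroup.comap_map_eq_self_of_injective θ.injective] at this
  rcases hH with rfl | h6
  · refine ⟨MulEquiv.refl _, ?_⟩
    rw [show (alternatingGroup (Fin 6)).map (MulEquiv.refl (Perm (Fin 6))).toMonoidHom =
      alternatingGroup (Fin 6) from Subgroup.map_id _]
    exact hasRegularTwoPointStabilizers_alternatingGroup
  · rcases isPretransitive_or_eq_stabilizer h6 with hT | ⟨i, hi⟩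
    · refine ⟨MulEquiv.refl _, ?_⟩
      rw [show H.map (MulEquiv.refl (Perm (Fin 6))).toMonoidHom = H from Subgroup.map_id _]
      exact hasRegularTwoPointStabilizers_of_index_eq_six h6
    · obtain ⟨K, hK6, hKT⟩ := exists_isPretransitive_index_eq_six
      obtain ⟨ψ, hψ⟩ := exists_mulEquiv_of_index_eq_six hK6
      refine ⟨ψ, ?_⟩
      have hidx : (H.map ψ.toMonoidHom).index = 6 := by
        exact (Subgroup.index_map_equiv H ψ).trans h6
      rcases isPretransitive_or_eq_stabilizer hidx with hT' | ⟨j, hj⟩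
      · exact hasRegularTwoPointStabilizers_of_index_eq_six hidx
      -- `ψ` maps `K` onto the stabilizer of 0. If it also mapped `H` to a point stabilizer, `K`
      -- would be conjugate into `H` and fix a point, against transitivity.
      · exfalso
        obtain ⟨g, hg⟩ := exists_smul_eq (Perm (Fin 6)) (0 : Fin 6) j
        have hg' : g 0 = j := hg
        have hKi : ∀ k ∈ K, (ψ.symm g * k * (ψ.symm g)⁻¹) i = i := by
          intro k hk
          have hmem : ψ (ψ.symm g * k * (ψ.symm g)⁻¹) ∈ H.map ψ.toMonoidHom := by
            rw [hj, mem_stabilizer_iff, map_mul, map_mul, map_inv, ψ.apply_symm_apply]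
            change g (ψ k (g⁻¹ j)) = j
            rw [Perm.inv_eq_iff_eq.mpr hg'.symm, (hψ k).mp hk, hg']
          obtain ⟨x, hx, hxe⟩ := hmem
          rw [hi] at hx
          rw [← ψ.injective hxe]
          exact hx
        obtain ⟨y, hy⟩ := exists_ne ((ψ.symm g)⁻¹ i)
        obtain ⟨k, hk⟩ := exists_smul_eq K ((ψ.symm g)⁻¹ i) y
        have h := hKi k k.2
        rw [Perm.mul_apply, Perm.mul_apply] at h
        apply hy
        rw [← hk, eq_comm, Perm.inv_eq_iff_eq]
        exact h.symm

/-- A maximal subgroup irreducible on some module of dimension at least two is the alternating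
group or has index six. -/
theorem eq_alternatingGroup_or_index_eq_six_of_isIrreducibleOn {F V : Type*} [Field F]
    [AddCommGroup V] [Module F V] (h2 : (2 : F) ≠ 0)
    {ρ : Representation F (Perm (Fin 6)) V} {H : Subgroup (Perm (Fin 6))} (hH : IsCoatom H)
    (hρ : IsIrreducibleOn ρ H) (hd : 1 < Module.rank F V) :
    H = alternatingGroup (Fin 6) ∨ H.index = 6 := by
  have hstab : ∀ i : Fin 6, H ≤ stabilizer (Perm (Fin 6)) i → H.index = 6 := by
    intro i hi
    have h6 := index_stabilizer_fin_six i
    rcases hH.le_iff.mp hi with h | h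
    · rw [h, Subgroup.index_top] at h6
      omega
    · rw [← h, h6]
  by_cases h5 : 5 ∣ Nat.card H
  · rcases isPretransitive_or_le_stabilizer h5 with hT | ⟨i, hi⟩
    · exact eq_alternatingGroup_or_index_eq_six hH h5
    · exact Or.inr (hstab i hi)
  · rcases fixes_or_centralizes_or_preserves h5 with ⟨i, hi⟩ | ⟨z, hz, hz2, hc⟩ | ⟨B, hB, hp⟩
    · exact Or.inr (hstab i hi)
    · exact (not_isIrreducibleOn_of_commute hρ hd hz hz2 hc).elim
    · obtain ⟨σ, hσ⟩ := exists_perm_of_ncard_eq_three hB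
      refine (not_isIrreducibleOn_of_preserves_partition h2 (hρ.comp_mulEquiv (MulAut.conj σ)) hd
        fun h hh => ?_).elim
      have hh' : σ * h * σ⁻¹ ∈ H := hh
      have key : ∀ i, (σ * h * σ⁻¹) (σ i) = σ (h i) := fun i => by simp
      simp only [← hσ, ← key]
      exact (hp _ hh').imp (fun e i hi => e _ hi) fun e i hi => e _ hi

end Conclusions

/-! ### The six forms of Witt defect one and `Sp₄(2) ≅ S₆` -/

section MinusForms

/-- The bilinear form preserved by `Sp₄(2)`, in coordinates. -/
def sympForm (x y : NatMod42) : ZMod 2 :=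
  x (.inl 0) * y (.inr 0) + x (.inl 1) * y (.inr 1) + x (.inr 0) * y (.inl 0) +
    x (.inr 1) * y (.inl 1)

/-- The value at `x` of the quadratic form polarizing to the symplectic form that takes the
values `a` on the standard basis. -/
def formValue (a x : NatMod42) : ZMod 2 :=
  x (.inl 0) * x (.inr 0) + x (.inl 1) * x (.inr 1) + a (.inl 0) * (x (.inl 0) * x (.inl 0)) +
    a (.inl 1) * (x (.inl 1) * x (.inl 1)) + a (.inr 0) * (x (.inr 0) * x (.inr 0)) +
    a (.inr 1) * (x (.inr 1) * x (.inr 1))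

/-- The Arf invariant of the quadratic form with values `a` on the standard basis. -/
def arf (a : NatMod42) : ZMod 2 := a (.inl 0) * a (.inr 0) + a (.inl 1) * a (.inr 1)

theorem dotProduct_J_mulVec : ∀ x y : NatMod42,
    dotProduct x ((Matrix.J (Fin 2) (ZMod 2)).mulVec y) = sympForm x y := by
  intro x y
  rw [Matrix.J, Matrix.fromBlocks_mulVec]
  simp [dotProduct, Fintype.sum_sum_type, sympForm, Fin.sum_univ_two, Matrix.neg_mulVec]
  ring

-- Arf invariant 0 is the hyperbolic case, so there is a totally singular plane `{0, x, y, x + y}`.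
-- With sixteen forms and sixteen vectors, exhaustive search suffices.
set_option maxRecDepth 100000 in
theorem exists_singular_plane : ∀ a : NatMod42, arf a = 0 →
    ∃ x y : NatMod42, x ≠ 0 ∧ y ≠ 0 ∧ x ≠ y ∧ formValue a x = 0 ∧ formValue a y = 0 ∧
      formValue a (x + y) = 0 := by
  decide +kernel

set_option maxRecDepth 100000 in
set_option synthInstance.maxHeartbeats 400000 in
set_option synthInstance.maxSize 2000 in
theorem not_exists_singular_plane : ∀ a : NatMod42, arf a = 1 →
    ∀ x y : NatMod42, x ≠ 0 → y ≠ 0 → x ≠ y → formValue a x = 0 → formValue a y = 0 →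
      formValue a (x + y) ≠ 0 := by
  decide +kernel

set_option maxRecDepth 100000 in
theorem exists_singular_vector : ∀ a : NatMod42, ∃ x : NatMod42, x ≠ 0 ∧ formValue a x = 0 := by
  decide +kernel

-- This separation of vectors makes the action on the six forms faithful.
set_option maxRecDepth 100000 in
theorem eq_of_formValue_eq : ∀ x y : NatMod42,
    (∀ a, arf a = 1 → formValue a x = formValue a y) → x = y := by
  decide +kernel

-- Forms with the same polarization differ by the square of a linear functional `(·, v)`. The values
-- at `v` are those for which the transvection along `v` exchanges the forms `a` and `b` and fixes
-- the other four.
set_option maxRecDepth 100000 in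
set_option synthInstance.maxHeartbeats 400000 in
set_option synthInstance.maxSize 2000 in
theorem exists_transvection_vector : ∀ a b : NatMod42, arf a = 1 → arf b = 1 → a ≠ b →
    ∃ v : NatMod42, (∀ x, formValue b x = formValue a x + sympForm x v * sympForm x v) ∧
      formValue a v = 0 ∧ formValue b v = 0 ∧
      ∀ c, arf c = 1 → c ≠ a → c ≠ b → formValue c v = 1 := by
  decide +kernel

theorem card_arf_eq_one : Fintype.card {a : NatMod42 // arf a = 1} = 6 := by
  decide +kernel

/-- The quadratic form polarizing to the symplectic form with values `a` on the standard basis. -/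
def quadraticFormOf (a : NatMod42) : QuadraticForm (ZMod 2) NatMod42 :=
  QuadraticMap.proj (.inl 0) (.inr 0) + QuadraticMap.proj (.inl 1) (.inr 1) +
    a (.inl 0) • QuadraticMap.proj (.inl 0) (.inl 0) +
    a (.inl 1) • QuadraticMap.proj (.inl 1) (.inl 1) +
    a (.inr 0) • QuadraticMap.proj (.inr 0) (.inr 0) +
    a (.inr 1) • QuadraticMap.proj (.inr 1) (.inr 1)

theorem quadraticFormOf_apply (a x : NatMod42) : quadraticFormOf a x = formValue a x := by
  simp [quadraticFormOf, formValue]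

theorem polar_quadraticFormOf (a x y : NatMod42) :
    QuadraticMap.polar (quadraticFormOf a) x y = sympForm x y := by
  have h2 : (2 : ZMod 2) = 0 := rfl
  simp only [QuadraticMap.polar, quadraticFormOf_apply, formValue, sympForm, Pi.add_apply]
  linear_combination (a (.inl 0) * x (.inl 0) * y (.inl 0) + a (.inl 1) * x (.inl 1) * y (.inl 1) +
    a (.inr 0) * x (.inr 0) * y (.inr 0) + a (.inr 1) * x (.inr 1) * y (.inr 1)) * h2

/-- The difference of two forms with equal polarization is additive, so it vanishes once it does on
the basis. -/
theorem eq_quadraticFormOf {Q : QuadraticForm (ZMod 2) NatMod42}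
    (hQ : ∀ x y, QuadraticMap.polar Q x y = sympForm x y) :
    Q = quadraticFormOf fun i => Q (Pi.single i 1) := by
  obtain ⟨a, ha⟩ : ∃ a : NatMod42, a = fun i => Q (Pi.single i 1) := ⟨_, rfl⟩
  rw [← ha]
  let D : NatMod42 →+ ZMod 2 :=
    { toFun := fun x => Q x - quadraticFormOf a x
      map_zero' := by simp
      map_add' := fun x y => by
        have h1 := hQ x y
        rw [← polar_quadraticFormOf a, QuadraticMap.polar, QuadraticMap.polar] at h1
        linear_combination h1 }
  have hD : D = 0 := by
    apply AddMonoidHom.functions_ext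
    intro i c
    have hc : c = 0 ∨ c = 1 := by revert c; decide
    rcases hc with rfl | rfl
    · simp
    · change Q (Pi.single i 1) - quadraticFormOf a (Pi.single i 1) = 0
      rw [show Q (Pi.single i 1) = a i by rw [ha], quadraticFormOf_apply]
      rcases i with i | i <;> fin_cases i <;> simp [formValue]
  ext x
  exact sub_eq_zero.mp (DFunLike.congr_fun hD x)

/-- Boundedness is what makes the `sSup` in `wittIndex` a genuine maximum. -/
theorem bddAbove_wittIndex (Q : QuadraticForm (ZMod 2) NatMod42) :
    BddAbove {d | ∃ W : Submodule (ZMod 2) NatMod42, (∀ w ∈ W, Q w = 0) ∧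
      Module.finrank (ZMod 2) W = d} := by
  refine ⟨Module.finrank (ZMod 2) NatMod42, ?_⟩
  rintro _ ⟨W, -, rfl⟩
  exact W.finrank_le

theorem zmod_two_cases (c : ZMod 2) : c = 0 ∨ c = 1 := by
  revert c; decide

theorem linearIndependent_pair_zmod_two {x y : NatMod42} (hx : x ≠ 0) (hy : y ≠ 0) (hxy : x ≠ y) :
    LinearIndependent (ZMod 2) ![x, y] := by
  rw [LinearIndependent.pair_iff]
  intro s t hst
  have h2 : ∀ v : NatMod42, -v = v := by decide
  rcases zmod_two_cases s with rfl | rfl <;> rcases zmod_two_cases t with rfl | rfl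
  · exact ⟨rfl, rfl⟩
  · simp only [zero_smul, one_smul, zero_add] at hst
    exact absurd hst hy
  · simp only [zero_smul, one_smul, add_zero] at hst
    exact absurd hst hx
  · simp only [one_smul] at hst
    exact absurd ((eq_neg_of_add_eq_zero_left hst).trans (h2 y)) hxy

theorem two_le_wittIndex {Q : QuadraticForm (ZMod 2) NatMod42} {x y : NatMod42} (hx : x ≠ 0)
    (hy : y ≠ 0) (hxy : x ≠ y) (hQx : Q x = 0) (hQy : Q y = 0) (hQxy : Q (x + y) = 0) :
    2 ≤ wittIndex Q := by
  apply le_csSup (bddAbove_wittIndex Q)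
  refine ⟨Submodule.span (ZMod 2) {x, y}, fun w hw => ?_, ?_⟩
  · obtain ⟨s, t, rfl⟩ := Submodule.mem_span_pair.mp hw
    rcases zmod_two_cases s with rfl | rfl <;> rcases zmod_two_cases t with rfl | rfl <;>
      simp [hQx, hQy, hQxy]
  · have h := finrank_span_eq_card (linearIndependent_pair_zmod_two hx hy hxy)
    rwa [Matrix.range_cons_cons_empty, Fintype.card_fin] at h

theorem wittIndex_eq_one {Q : QuadraticForm (ZMod 2) NatMod42} {x : NatMod42} (hx : x ≠ 0)
    (hQx : Q x = 0) (h : ∀ x y : NatMod42, x ≠ 0 → y ≠ 0 → x ≠ y → Q x = 0 → Q y = 0 →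
      Q (x + y) ≠ 0) : wittIndex Q = 1 := by
  apply le_antisymm
  · apply csSup_le
    · exact ⟨_, ⊥, by simp, rfl⟩
    · rintro _ ⟨W, hW, rfl⟩
      by_contra hlt
      rw [not_le] at hlt
      have hnt : Nontrivial W := Module.nontrivial_of_finrank_pos (R := ZMod 2) (by omega)
      obtain ⟨⟨u, hu⟩, hu0⟩ := exists_ne (0 : W)
      obtain ⟨⟨v, hv⟩, hvu⟩ := exists_linearIndependent_pair_of_one_lt_finrank hlt hu0
      have hne := hvu.ne_zero 1
      rw [LinearIndependent.pair_iff] at hvu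
      have hneq : (⟨u, hu⟩ : W) ≠ ⟨v, hv⟩ := fun e => by
        have := hvu 1 (-1) (by rw [e, one_smul, neg_one_smul, add_neg_cancel])
        exact one_ne_zero this.1
      exact h u v (fun e => hu0 (Subtype.ext e)) (fun e => hne (Subtype.ext e))
        (fun e => hneq (Subtype.ext e)) (hW u hu) (hW v hv) (hW _ (W.add_mem hu hv))
  · apply le_csSup (bddAbove_wittIndex Q)
    refine ⟨Submodule.span (ZMod 2) {x}, fun w hw => ?_, finrank_span_singleton hx⟩
    obtain ⟨s, rfl⟩ := Submodule.mem_span_singleton.mp hw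
    rcases zmod_two_cases s with rfl | rfl <;> simp [hQx]

theorem isMinusForm_quadraticFormOf (a : NatMod42) :
    IsMinusForm (quadraticFormOf a) ↔ arf a = 1 := by
  have hr : Module.finrank (ZMod 2) NatMod42 = 4 := by simp
  constructor
  · rintro ⟨-, h⟩
    rw [hr] at h
    refine (zmod_two_cases _).resolve_left fun h0 => ?_
    obtain ⟨x, y, hx, hy, hxy, h1, h2, h3⟩ := exists_singular_plane a h0
    simp only [← quadraticFormOf_apply] at h1 h2 h3
    have := two_le_wittIndex hx hy hxy h1 h2 h3
    omega
  · intro h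
    refine ⟨fun x y => by rw [polar_quadraticFormOf, dotProduct_J_mulVec], ?_⟩
    obtain ⟨x, hx, hx0⟩ := exists_singular_vector a
    rw [← quadraticFormOf_apply] at hx0
    rw [hr, wittIndex_eq_one hx hx0]
    simpa only [quadraticFormOf_apply] using not_exists_singular_plane a h

theorem quadraticFormOf_injective : Function.Injective quadraticFormOf := by
  intro a b hab
  ext i
  have : formValue a (Pi.single i 1) = formValue b (Pi.single i 1) := by
    rw [← quadraticFormOf_apply, hab, quadraticFormOf_apply]
  rcases i with i | i <;> fin_cases i <;> simpa [formValue] using this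

/-- The six quadratic forms of Witt defect one polarizing to the symplectic form. -/
abbrev MinusForm : Type := {Q : QuadraticForm (ZMod 2) NatMod42 // IsMinusForm Q}

theorem IsMinusForm.exists_eq_quadraticFormOf {Q : QuadraticForm (ZMod 2) NatMod42}
    (hQ : IsMinusForm Q) : ∃ a, arf a = 1 ∧ Q = quadraticFormOf a := by
  have e := eq_quadraticFormOf fun x y => by rw [← dotProduct_J_mulVec]; exact hQ.1 x y
  generalize (fun i => Q (Pi.single i 1)) = a at e
  subst e
  exact ⟨a, (isMinusForm_quadraticFormOf a).mp hQ, rfl⟩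

/-- A form of Witt defect one is determined by its values on the standard basis. -/
noncomputable def minusFormEquiv : {a : NatMod42 // arf a = 1} ≃ MinusForm :=
  Equiv.ofBijective (fun a => ⟨quadraticFormOf a, (isMinusForm_quadraticFormOf a).mpr a.2⟩)
    ⟨fun _ _ hab => Subtype.ext (quadraticFormOf_injective (congrArg Subtype.val hab)),
      fun Q => by
        obtain ⟨a, ha, hQ⟩ := Q.2.exists_eq_quadraticFormOf
        exact ⟨⟨a, ha⟩, Subtype.ext hQ.symm⟩⟩

theorem card_minusForm : Nat.card MinusForm = 6 := by
  rw [← Nat.card_congr minusFormEquiv, Nat.card_eq_fintype_card, card_arf_eq_one]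

theorem wittIndex_comp_le {Q : QuadraticForm (ZMod 2) NatMod42}
    (e : NatMod42 ≃ₗ[ZMod 2] NatMod42) : wittIndex (Q.comp e.toLinearMap) ≤ wittIndex Q := by
  apply csSup_le
  · exact ⟨_, ⊥, by simp, rfl⟩
  · rintro _ ⟨W, hW, rfl⟩
    apply le_csSup (bddAbove_wittIndex Q)
    refine ⟨W.map e.toLinearMap, ?_, LinearEquiv.finrank_map_eq e W⟩
    rintro _ ⟨w, hw, rfl⟩
    exact hW w hw

theorem wittIndex_comp {Q : QuadraticForm (ZMod 2) NatMod42} (e : NatMod42 ≃ₗ[ZMod 2] NatMod42) :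
    wittIndex (Q.comp e.toLinearMap) = wittIndex Q := by
  apply le_antisymm (wittIndex_comp_le e)
  have h := wittIndex_comp_le (Q := Q.comp e.toLinearMap) e.symm
  have hQ : (Q.comp e.toLinearMap).comp e.symm.toLinearMap = Q := by
    ext x
    simp
  rwa [hQ] at h

theorem mulVec_mulVec_inv (A : Sp42) (x : NatMod42) : A.1.mulVec ((A⁻¹).1.mulVec x) = x := by
  rw [Matrix.mulVec_mulVec, show A.1 * (A⁻¹).1 = 1 from congrArg Subtype.val (mul_inv_cancel A),
    Matrix.one_mulVec]

theorem sympForm_mulVec (A : Sp42) (x y : NatMod42) :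
    sympForm (A.1.mulVec x) (A.1.mulVec y) = sympForm x y := by
  rw [← dotProduct_J_mulVec, ← dotProduct_J_mulVec, Matrix.dotProduct_mulVec, Matrix.vecMul_mulVec,
    ← Matrix.dotProduct_mulVec, Matrix.mulVec_mulVec, SymplecticGroup.mem_iff'.mp A.2]

/-- The linear automorphism given by a symplectic matrix. -/
def mulVecEquiv (A : Sp42) : NatMod42 ≃ₗ[ZMod 2] NatMod42 :=
  { A.1.mulVecLin with
    invFun := (A⁻¹).1.mulVec
    left_inv := fun x => by
      have := mulVec_mulVec_inv A⁻¹ x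
      rwa [inv_inv] at this
    right_inv := mulVec_mulVec_inv A }

theorem IsMinusForm.comp {Q : QuadraticForm (ZMod 2) NatMod42} (hQ : IsMinusForm Q) (A : Sp42) :
    IsMinusForm (Q.comp (mulVecEquiv A).toLinearMap) := by
  refine ⟨fun x y => ?_, by rw [wittIndex_comp]; exact hQ.2⟩
  have h := hQ.1 (A.1.mulVec x) (A.1.mulVec y)
  rw [dotProduct_J_mulVec, sympForm_mulVec, ← dotProduct_J_mulVec] at h
  rw [← h, QuadraticMap.polar, QuadraticMap.polar, ← Matrix.mulVec_add]
  rfl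

/-- `Sp₄(2)` permutes the forms of Witt defect one. -/
noncomputable instance : MulAction Sp42 MinusForm where
  smul A Q := ⟨Q.1.comp (mulVecEquiv A⁻¹).toLinearMap, Q.2.comp A⁻¹⟩
  one_smul Q := Subtype.ext (QuadraticMap.ext fun x => by
    change Q.1 ((1⁻¹ : Sp42).1.mulVec x) = Q.1 x
    rw [inv_one, show (1 : Sp42).1 = 1 from rfl, Matrix.one_mulVec])
  mul_smul A B Q := Subtype.ext (QuadraticMap.ext fun x => by
    change Q.1 ((A * B)⁻¹.1.mulVec x) = Q.1 ((B⁻¹).1.mulVec ((A⁻¹).1.mulVec x))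
    rw [mul_inv_rev, Matrix.mulVec_mulVec]
    rfl)

theorem smul_minusForm_apply (A : Sp42) (Q : MinusForm) (x : NatMod42) :
    (A • Q).1 x = Q.1 ((A⁻¹).1.mulVec x) := rfl

theorem orthogonalSubgroup_eq_stabilizer (Q : MinusForm) :
    orthogonalSubgroup Q.1 = MulAction.stabilizer Sp42 Q := by
  ext A
  -- The action precomposes with the inverse matrix, hence the passage to `A⁻¹`.
  rw [← inv_mem_iff, MulAction.mem_stabilizer_iff]
  constructor
  · intro h
    exact Subtype.ext (QuadraticMap.ext h)
  · intro h x
    exact QuadraticMap.congr_fun (congrArg Subtype.val h) x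

theorem toPermHom_minusForm_injective :
    Function.Injective (MulAction.toPermHom Sp42 MinusForm) := by
  rw [← MonoidHom.ker_eq_bot_iff, Subgroup.eq_bot_iff_forall]
  intro A hA
  rw [← inv_eq_one]
  have key : ∀ x, (A⁻¹).1.mulVec x = x := fun x => by
    apply eq_of_formValue_eq
    intro a ha
    let Q : MinusForm := ⟨quadraticFormOf a, (isMinusForm_quadraticFormOf a).mpr ha⟩
    have h1 : A • Q = Q := Perm.ext_iff.mp hA Q
    have h2 := smul_minusForm_apply A Q x
    rw [h1] at h2
    rw [← quadraticFormOf_apply, ← quadraticFormOf_apply]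
    exact h2.symm
  apply Subtype.ext
  apply Matrix.mulVec_injective
  ext1 x
  rw [key x]
  exact (Matrix.one_mulVec x).symm

/-- The matrix of the transvection `x ↦ x + (x, v) v`. -/
def transvectionMatrix (v : NatMod42) : Matrix (Fin 2 ⊕ Fin 2) (Fin 2 ⊕ Fin 2) (ZMod 2) :=
  1 + Matrix.vecMulVec v ((Matrix.J (Fin 2) (ZMod 2)).mulVec v)

theorem transvectionMatrix_mulVec (v x : NatMod42) :
    (transvectionMatrix v).mulVec x = x + sympForm x v • v := by
  rw [transvectionMatrix, Matrix.add_mulVec, Matrix.one_mulVec, Matrix.vecMulVec_mulVec,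
    dotProduct_comm, dotProduct_J_mulVec]
  ext i
  simp [mul_comm]

theorem transvectionMatrix_mem : ∀ v : NatMod42,
    transvectionMatrix v * Matrix.J (Fin 2) (ZMod 2) * (transvectionMatrix v).transpose =
      Matrix.J (Fin 2) (ZMod 2) := by
  decide +kernel

/-- The transvection `x ↦ x + (x, v) v`. -/
def sympTransvection (v : NatMod42) : Sp42 :=
  ⟨transvectionMatrix v, SymplecticGroup.mem_iff.mpr (transvectionMatrix_mem v)⟩

theorem sympTransvection_inv (v : NatMod42) : (sympTransvection v)⁻¹ = sympTransvection v := by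
  have h : ∀ v : NatMod42, transvectionMatrix v * transvectionMatrix v = 1 := by decide +kernel
  exact inv_eq_of_mul_eq_one_left (Subtype.ext (h v))

/-- Polarization contributes `(x, v)²`. So the transvection along `v` fixes the form when its value
at `v` is 1 and adds `(x, v)²` when it is 0. -/
theorem formValue_add_smul (a x v : NatMod42) :
    formValue a (x + sympForm x v • v) =
      formValue a x + sympForm x v * sympForm x v * (1 + formValue a v) := by
  have h := polar_quadraticFormOf a x (sympForm x v • v)
  rw [QuadraticMap.polar, QuadraticMap.map_smul, quadraticFormOf_apply, quadraticFormOf_apply,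
    quadraticFormOf_apply] at h
  have h' : sympForm x (sympForm x v • v) = sympForm x v * sympForm x v := by
    conv_lhs => rw [sympForm]
    simp only [Pi.smul_apply, smul_eq_mul]
    conv_rhs => rw [sympForm]
    rw [sympForm]
    ring
  rw [h'] at h
  simp only [smul_eq_mul] at h
  linear_combination h

/-- Transpositions generate, and each one is the action of a transvection. -/
theorem toPermHom_minusForm_surjective :
    Function.Surjective (MulAction.toPermHom Sp42 MinusForm) := by
  classical
  have : Finite MinusForm := Nat.finite_of_card_ne_zero (by rw [card_minusForm]; omega)
  rw [← MonoidHom.range_eq_top, eq_top_iff, ← Perm.closure_isSwap, Subgroup.closure_le]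
  rintro _ ⟨Q, R, hQR, rfl⟩
  obtain ⟨⟨a, ha⟩, rfl⟩ := minusFormEquiv.surjective Q
  obtain ⟨⟨b, hb⟩, rfl⟩ := minusFormEquiv.surjective R
  have hab : a ≠ b := by
    rintro rfl
    exact hQR rfl
  obtain ⟨v, hba, hav, hbv, hc⟩ := exists_transvection_vector a b ha hb hab
  have hval : ∀ (c : {a : NatMod42 // arf a = 1}) (x : NatMod42),
      (sympTransvection v • minusFormEquiv c).1 x = formValue c (x + sympForm x v • v) := by
    intro c x
    rw [smul_minusForm_apply, sympTransvection_inv]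
    change quadraticFormOf c ((transvectionMatrix v).mulVec x) = _
    rw [transvectionMatrix_mulVec, quadraticFormOf_apply]
  have hval' : ∀ (c : {a : NatMod42 // arf a = 1}) (x : NatMod42),
      (minusFormEquiv c).1 x = formValue c x := fun c x => quadraticFormOf_apply c x
  refine ⟨sympTransvection v, Perm.ext fun R => ?_⟩
  obtain ⟨⟨c, hc1⟩, rfl⟩ := minusFormEquiv.surjective R
  change sympTransvection v • minusFormEquiv ⟨c, hc1⟩ = _
  by_cases hca : c = a
  · subst hca
    rw [swap_apply_left]
    refine Subtype.ext (QuadraticMap.ext fun x => ?_)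
    rw [hval, hval', formValue_add_smul, hav, hba]
    ring
  by_cases hcb : c = b
  · subst hcb
    rw [swap_apply_right]
    refine Subtype.ext (QuadraticMap.ext fun x => ?_)
    rw [hval, hval', formValue_add_smul, hbv, hba]
    have h2 : (2 : ZMod 2) = 0 := rfl
    linear_combination (sympForm x v * sympForm x v) * h2
  · rw [swap_apply_of_ne_of_ne]
    · refine Subtype.ext (QuadraticMap.ext fun x => ?_)
      rw [hval, hval', formValue_add_smul, hc c hc1 hca hcb]
      have h2 : (1 : ZMod 2) + 1 = 0 := rfl
      rw [h2, mul_zero, add_zero]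
    · exact fun e => hca (congrArg Subtype.val (minusFormEquiv.injective e))
    · exact fun e => hcb (congrArg Subtype.val (minusFormEquiv.injective e))

/-- `Sp₄(2) ≅ S₆`, such that the subgroups `O₄⁻(2)` are the point stabilizers. -/
theorem exists_mulEquiv_perm : ∃ φ : Sp42 ≃* Perm (Fin 6), ∀ H : Subgroup Sp42,
    IsO4Minus H ↔ ∃ i : Fin 6, H.map φ.toMonoidHom = MulAction.stabilizer (Perm (Fin 6)) i := by
  have : Finite MinusForm := Nat.finite_of_card_ne_zero (by rw [card_minusForm]; omega)
  let e : MinusForm ≃ Fin 6 := Finite.equivFinOfCardEq card_minusForm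
  let φ : Sp42 ≃* Perm (Fin 6) :=
    (MulEquiv.ofBijective _ ⟨toPermHom_minusForm_injective, toPermHom_minusForm_surjective⟩).trans
      e.permCongrHom
  have hφ : ∀ Q : MinusForm, MulAction.stabilizer Sp42 Q =
      (MulAction.stabilizer (Perm (Fin 6)) (e Q)).comap φ.toMonoidHom := by
    intro Q
    ext A
    change A • Q = Q ↔ e (A • e.symm (e Q)) = e Q
    rw [e.symm_apply_apply, e.apply_eq_iff_eq]
  refine ⟨φ, fun H => ?_⟩
  constructor
  · rintro ⟨Q, hQ, rfl⟩
    refine ⟨e ⟨Q, hQ⟩, ?_⟩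
    rw [orthogonalSubgroup_eq_stabilizer ⟨Q, hQ⟩, hφ]
    exact Subgroup.map_comap_eq_self_of_surjective φ.surjective _
  · rintro ⟨i, hi⟩
    refine ⟨(e.symm i).1, (e.symm i).2, ?_⟩
    rw [orthogonalSubgroup_eq_stabilizer, hφ, e.apply_symm_apply, ← hi,
      Subgroup.comap_map_eq_self_of_injective φ.injective]

end MinusForms

/-! ### Almost simplicity -/

section AlmostSimple

theorem IsAlmostSimple.of_mulEquiv {G G' : Type*} [Group G] [Group G'] (h : IsAlmostSimple G)
    (e : G ≃* G') : IsAlmostSimple G' := by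
  obtain ⟨S, hS, hsimple, ⟨a, b, hab⟩, hc⟩ := h
  let f := e.subgroupMap S
  refine ⟨S.map (e : G →* G'), hS.map _ e.surjective, f.symm.isSimpleGroup,
    ⟨f a, f b, fun h => hab (f.injective (by rw [map_mul, map_mul, h]))⟩, ?_⟩
  rw [Subgroup.eq_bot_iff_forall] at hc ⊢
  intro x hx
  have := hc (e.symm x) (Subgroup.mem_centralizer_iff.mpr fun s hs => e.injective (by
    have h1 := Subgroup.mem_centralizer_iff.mp hx (e s) ⟨s, hs, rfl⟩
    rw [map_mul, map_mul, e.apply_symm_apply]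
    exact h1))
  rwa [map_eq_one_iff e.symm e.symm.injective] at this

/-- The centralizer of `A₆` is normal; if nontrivial it would contain `A₆` and make it abelian. -/
theorem isAlmostSimple_perm : IsAlmostSimple (Perm (Fin 6)) := by
  obtain ⟨a, b, hab⟩ : ∃ a b : alternatingGroup (Fin 6), a * b ≠ b * a := by
    refine ⟨⟨c[0, 1, 2], Perm.mem_alternatingGroup.mpr (by decide)⟩,
      ⟨c[1, 2, 3], Perm.mem_alternatingGroup.mpr (by decide)⟩, fun h => ?_⟩
    exact absurd (congrArg Subtype.val h) (by decide)
  refine ⟨alternatingGroup (Fin 6), inferInstance, alternatingGroup.isSimpleGroup (by simp),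
    ⟨a, b, hab⟩, ?_⟩
  by_contra hne
  have hle := Perm.alternatingGroup_le_of_normal (by simp)
    ((Subgroup.nontrivial_iff_ne_bot (Subgroup.centralizer (alternatingGroup (Fin 6) :
      Set (Perm (Fin 6))))).mpr hne)
  exact hab (Subtype.ext (Subgroup.mem_centralizer_iff.mp (hle b.2) a a.2))

theorem isAlmostSimple_quotient_center (φ : Sp42 ≃* Perm (Fin 6)) :
    IsAlmostSimple (Sp42 ⧸ Subgroup.center Sp42) := by
  have hc : Subgroup.center Sp42 = ⊥ := by
    rw [Subgroup.eq_bot_iff_forall]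
    intro z hz
    by_contra hne
    obtain ⟨g, hg⟩ := exists_not_commute (z := φ z) fun h => hne (φ.injective (h.trans φ.map_one.symm))
    apply hg
    have := congrArg φ (Subgroup.mem_center_iff.mp hz (φ.symm g))
    simpa using this
  exact isAlmostSimple_perm.of_mulEquiv
    (φ.symm.trans (QuotientGroup.quotientBot.symm.trans (QuotientGroup.quotientMulEquivOfEq hc.symm)))

end AlmostSimple

/-! ### Transport along `Sp₄(2) ≅ S₆` -/

section Transport

variable (φ : Sp42 ≃* Perm (Fin 6)) {H : Subgroup Sp42}

theorem isCoatom_map_iff : IsCoatom (H.map φ.toMonoidHom) ↔ IsCoatom H :=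
  (MulEquiv.mapSubgroup φ).isCoatom_iff H

/-- `A₆` is the only subgroup of index two in `S₆`, so the order alone identifies it. -/
theorem isA6_iff : IsA6 H ↔ H.map φ.toMonoidHom = alternatingGroup (Fin 6) := by
  constructor
  · rintro ⟨e⟩
    apply Perm.eq_alternatingGroup_of_index_eq_two
    have h1 := Nat.card_congr ((φ.subgroupMap H).symm.trans e).toEquiv
    have h2 := card_mul_index_eq (H.map φ.toMonoidHom)
    rw [card_alternatingGroup_fin_six] at h1
    change Nat.card (H.map φ.toMonoidHom) = 360 at h1
    rw [h1] at h2
    omega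
  · intro h
    exact ⟨(φ.subgroupMap H).trans (MulEquiv.subgroupCongr h)⟩

theorem nonempty_mulEquiv_perm_iff :
    Nonempty (H ≃* Perm (Fin 5)) ↔ (H.map φ.toMonoidHom).index = 6 := by
  constructor
  · rintro ⟨e⟩
    exact index_eq_six_of_mulEquiv ((φ.subgroupMap H).symm.trans e)
  · intro h
    obtain ⟨e⟩ := nonempty_mulEquiv_of_index_eq_six h
    exact ⟨(φ.subgroupMap H).trans e⟩

theorem isIrreducibleOn_map_iff {F V : Type*} [Field F] [AddCommGroup V] [Module F V]
    (ρ : Representation F Sp42 V) :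
    IsIrreducibleOn (ρ.comp φ.symm.toMonoidHom : Representation F (Perm (Fin 6)) V)
      (H.map φ.toMonoidHom) ↔ IsIrreducibleOn ρ H := by
  refine and_congr Iff.rfl (forall_congr' fun W => imp_congr_left ?_)
  constructor
  · intro h g hg w hw
    have := h (φ g) ⟨g, hg, rfl⟩ w hw
    simpa using this
  · rintro h _ ⟨g, hg, rfl⟩ w hw
    simpa using h g hg w hw

theorem two_ne_zero_of_charP {ℓ : ℕ} (hℓ : ℓ ≠ 2) (F : Type*) [Field F] [CharP F ℓ] :
    (2 : F) ≠ 0 := fun h => by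
  have hd : ℓ ∣ 2 := (CharP.cast_eq_zero_iff F ℓ 2).mp (by exact_mod_cast h)
  rcases (Nat.dvd_prime Nat.prime_two).mp hd with rfl | rfl
  · exact CharP.char_ne_one F 1 rfl
  · exact hℓ rfl

end Transport

/-! ### The main theorem -/

theorem mainTheorem5 (ℓ : ℕ) (hℓ : ℓ ≠ 2) (F : Type u) [Field F] [IsAlgClosed F] [CharP F ℓ] :
    -- the isomorphisms `Sp₄(2) ≅ S₆` and `O₄⁻(2) ≅ S₅`
    Nonempty (Sp42 ≃* Equiv.Perm (Fin 6)) ∧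
    (∀ H : Subgroup Sp42, IsO4Minus H → Nonempty (H ≃* Equiv.Perm (Fin 5))) ∧
    -- the possible maximal subgroups
    (∀ (V : Type v) [AddCommGroup V] [Module F V] (ρ : Representation F Sp42 V)
      (H : Subgroup Sp42), IsCoatom H → IsIrreducibleRestrictionTriple ρ H →
        IsA6 H ∨ IsOtherS5 H ∨ IsO4Minus H) ∧
    -- each of these subgroups gives rise to a triple
    (∀ H : Subgroup Sp42, IsCoatom H → IsA6 H ∨ IsOtherS5 H ∨ IsO4Minus H →
      ∃ (V : Type u) (_ : AddCommGroup V) (_ : Module F V) (ρ : Representation F Sp42 V),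
        IsIrreducibleRestrictionTriple ρ H) ∧
    -- each of the three kinds of maximal subgroups exists
    (∃ H : Subgroup Sp42, IsCoatom H ∧ IsA6 H) ∧
    (∃ H : Subgroup Sp42, IsCoatom H ∧ IsOtherS5 H) ∧
    (∃ H : Subgroup Sp42, IsCoatom H ∧ IsO4Minus H) := by
  have h2 : (2 : F) ≠ 0 := two_ne_zero_of_charP hℓ F
  obtain ⟨φ, hφ⟩ := exists_mulEquiv_perm
  have hO : ∀ H : Subgroup Sp42, IsO4Minus H → (H.map φ.toMonoidHom).index = 6 := by
    intro H hH
    obtain ⟨i, hi⟩ := (hφ H).mp hH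
    rw [hi]
    exact index_stabilizer_fin_six i
  have hmap : ∀ K : Subgroup (Perm (Fin 6)), (K.comap φ.toMonoidHom).map φ.toMonoidHom = K :=
    Subgroup.map_comap_eq_self_of_surjective φ.surjective
  refine ⟨⟨φ⟩, fun H hH => (nonempty_mulEquiv_perm_iff φ).mpr (hO H hH), ?_, ?_, ?_, ?_, ?_⟩
  · intro V _ _ ρ H hH hT
    have hirr := (isIrreducibleOn_map_iff φ ρ).mpr ((isIrreducibleOn_iff ρ H).mp hT.irreducible)
    rcases eq_alternatingGroup_or_index_eq_six_of_isIrreducibleOn h2 ((isCoatom_map_iff φ).mpr hH)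
      hirr hT.one_lt_dim with h | h
    · exact Or.inl ((isA6_iff φ).mpr h)
    · by_cases hm : IsO4Minus H
      · exact Or.inr (Or.inr hm)
      · exact Or.inr (Or.inl ⟨(nonempty_mulEquiv_perm_iff φ).mpr h, hm⟩)
  · intro H hH hcases
    have h : H.map φ.toMonoidHom = alternatingGroup (Fin 6) ∨ (H.map φ.toMonoidHom).index = 6 := by
      rcases hcases with h | h | h
      · exact Or.inl ((isA6_iff φ).mp h)
      · exact Or.inr ((nonempty_mulEquiv_perm_iff φ).mp h.1)
      · exact Or.inr (hO H h)
    obtain ⟨θ, hθ⟩ := exists_isIrreducibleOn_heartRepresentation h2 h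
    let ρ : Representation F Sp42 (Heart F) :=
      ((heartRepresentation F).comp θ.toMonoidHom).comp φ.toMonoidHom
    refine ⟨Heart F, inferInstance, inferInstance, ρ, ?_⟩
    have hρ : (ρ.comp φ.symm.toMonoidHom : Representation F (Perm (Fin 6)) (Heart F)) =
        (heartRepresentation F).comp θ.toMonoidHom := by
      ext g : 1
      change heartRepresentation F (θ (φ (φ.symm g))) = heartRepresentation F (θ g)
      rw [φ.apply_symm_apply]
    rw [← hρ, isIrreducibleOn_map_iff] at hθ
    exact { finite := Finite.of_equiv _ φ.symm.toEquiv
            almostSimple := isAlmostSimple_quotient_center φ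
            one_lt_dim := one_lt_rank_heart F
            proper := hH.lt_top
            irreducible := (isIrreducibleOn_iff ρ H).mpr hθ }
  · refine ⟨(alternatingGroup (Fin 6)).comap φ.toMonoidHom, ?_, ?_⟩
    · rw [← isCoatom_map_iff φ, hmap]
      exact isCoatom_alternatingGroup
    · rw [isA6_iff φ, hmap]
  -- A transitive subgroup of index six fixes no point, so it does not correspond to an `O₄⁻(2)`.
  · obtain ⟨K, hK6, hKT⟩ := exists_isPretransitive_index_eq_six
    refine ⟨K.comap φ.toMonoidHom, ?_, ?_, fun hO' => ?_⟩
    · rw [← isCoatom_map_iff φ, hmap]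
      exact isCoatom_of_index_eq_six hK6
    · rw [nonempty_mulEquiv_perm_iff φ, hmap, hK6]
    · obtain ⟨i, hi⟩ := (hφ _).mp hO'
      rw [hmap] at hi
      obtain ⟨j, hj⟩ := exists_ne i
      obtain ⟨k, hk⟩ := MulAction.exists_smul_eq K i j
      have hki : (k : Perm (Fin 6)) ∈ MulAction.stabilizer (Perm (Fin 6)) i := hi ▸ k.2
      exact hj (hk.symm.trans hki)
  · refine ⟨(MulAction.stabilizer (Perm (Fin 6)) (0 : Fin 6)).comap φ.toMonoidHom, ?_, ?_⟩
    · rw [← isCoatom_map_iff φ, hmap]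
      exact isCoatom_of_index_eq_six (index_stabilizer_fin_six 0)
    · rw [hφ, hmap]
      exact ⟨0, rfl⟩
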